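/- Let $G=(V,E)$ be a finite simple graph with at least one vertex, and let $k>0$ be an integer. An (oriented) separation of $G$ is a pair $(A,B)$ of subsets of $V$ with $A\cup B=V$ such that $G$ has no edge between $A\setminus B$ and $B\setminus A$; its inverse is $(B,A)$, its order is $|A\cap B|$, and $(A,B)\le(C,D)$ means $A\subseteq C$ and $B\supseteq D$. Let $\vec S_k$ be the set of all oriented separations of $G$ of order less than $k$, and $S_k$ the corresponding set of unoriented separations $\{(A,B),(B,A)\}$. An orientation of $S_k$ is a set $O\subseteq\vec S_k$ containing exactly one of $(A,B),(B,A)$ for each separation in $S_k$ (if $(A,B)=(B,A)$, this means that it contains $(A,B)$). It is consistent if there are no $r<s$ in $\vec S_k$, orienting distinct separations, such that both the inverse of $r$ and $s$ itself lie in $O$. It avoids a set $\mathcal F'$ of subsets of $\vec S_k$ if no subset of $O$ is an element of $\mathcal F'$; an $\mathcal F'$-tangle of $S_k$ is a consistent orientation of $S_k$ that avoids $\mathcal F'$. Let $$\mathcal F=\big\{\{(A_1,B_1),(A_2,B_2),(A_3,B_3)\}\subseteq\vec S_k : G[A_1]\cup G[A_2]\cup G[A_3]=G\big\},$$ where the three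 separations need not be distinct, and let $\mathcal F^*$ be the set of those $\sigma\in\mathcal F$ that are stars: $(A,B)\le(D,C)$ for all distinct $(A,B),(C,D)\in\sigma$. A tangle of order $k$ in $G$ is an orientation of $S_k$ that avoids $\mathcal F$. An $S_k$-tree over $\mathcal F^*$ is a pair $(T,\alpha)$ of a finite tree $T$ with at least one edge and a map $\alpha$ from the oriented edges $(x,y)$ of $T$ to $\vec S_k$ such that $\alpha(y,x)$ is always the inverse of $\alpha(x,y)$, and $\{\alpha(x,t): xt\in E(T)\}\in\mathcal F^*$ for every node $t$ of $T$. A branch-decomposition of $G$ is a finite tree $T$ all whose nodes have degree $1$ or $3$ together with a bijection from $E$ to the set of leaves of $T$; its width is the maximum, over the edges $e$ of $T$, of the number of vertices of $G$ that are incident both with an edge of $G$ mapped to one component of $T-e$ and with an edge of $G$ mapped to the other. The branch-width of $G$ is the least width of a branch-decomposition of $G$ if $|E|\ge 2$, and $0$ if $|E|\le 1$. **Theorem.** The following assertions are equivalent: 1. $G$ has a tangle of order $k$. 2. $G$ has an $\mathcal F$-tangle of $S_k$. 3. $G$ has an $\mathcal F^*$-tangle of $S_k$. 4. $G$ has no $S_k$-tree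 over $\mathcal F^*$. 5. $G$ has branch-width at least $k$; or $k\le 2$ and $G$ is a disjoint union of stars and isolated vertices and has at least one edge; or $k=1$ and $G$ has no edge. -/

import Mathlib

namespace TangleDuality

/-! ### Abstract separation systems -/

/-- A separation system: a partially ordered set with an order-reversing involution.
Its elements are the oriented separations. -/
class SepSystem (U : Type*) extends PartialOrder U where
  /-- The inverse of an oriented separation. -/
  inv : U → U
  inv_inv : ∀ s, inv (inv s) = s
  inv_le_inv : ∀ r s, r ≤ s → inv s ≤ inv r

section Abstract

variable {U : Type*} [SepSystem U]

/-- `O` is an orientation of (the set of separations whose orientations form) `S`: it is a subset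
of `S` that contains, for every `s ∈ S`, exactly one element of the set `{s, inv s}`
(which may be a singleton). -/
def IsOrientation (S O : Set U) : Prop :=
  O ⊆ S ∧ ∀ s ∈ S, ∃! x, x ∈ ({s, SepSystem.inv s} : Set U) ∧ x ∈ O

/-- `O` is consistent in `S`: there are no orientations `r < s` of distinct (unoriented)
separations in `S` such that `inv r` and `s` lie in `O`. -/
def IsConsistent (S O : Set U) : Prop :=
  ¬ ∃ r ∈ S, ∃ s ∈ S, ({r, SepSystem.inv r} : Set U) ≠ {s, SepSystem.inv s} ∧ r < s ∧
    SepSystem.inv r ∈ O ∧ s ∈ O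

/-- `O` avoids `F`: no subset of `O` is an element of `F`. -/
def Avoids (F : Set (Set U)) (O : Set U) : Prop :=
  ∀ σ ∈ F, ¬ σ ⊆ O

/-- An `F`-tangle of `S` is a consistent orientation of `S` that avoids `F`. -/
structure IsFTangle (S : Set U) (F : Set (Set U)) (O : Set U) : Prop where
  orientation : IsOrientation S O
  consistent : IsConsistent S O
  avoids : Avoids F O

/-- A star of separations: a non-empty set of oriented separations
that point towards each other. -/
def IsSepStar (σ : Set U) : Prop :=
  σ.Nonempty ∧ ∀ r ∈ σ, ∀ s ∈ σ, r ≠ s → r ≤ SepSystem.inv s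

/-- An `S`-tree: a finite tree with at least one edge, together with a map `α` from the set of its
oriented edges (`T.Dart`) to `S` that commutes with inversion. -/
structure STree (S : Set U) where
  Node : Type
  finite_node : Finite Node
  T : SimpleGraph Node
  isTree : T.IsTree
  nonempty_dart : Nonempty T.Dart
  α : T.Dart → U
  α_mem : ∀ e, α e ∈ S
  α_symm : ∀ e : T.Dart, α e.symm = SepSystem.inv (α e)

/-- The image under `α` of the oriented star at the node `t`, which consists of all oriented
edges `(x, t)` with head `t`. -/
def STree.starAt {S : Set U} (X : STree S) (t : X.Node) : Set U :=
  X.α '' {e | e.snd = t}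

/-- The `S`-tree is over `F`: for each of its nodes the associated set lies in `F`. -/
def STree.IsOver {S : Set U} (X : STree S) (F : Set (Set U)) : Prop :=
  ∀ t, X.starAt t ∈ F

end Abstract

/-! ### Vertex separations of graphs and tangles -/

section Graph

variable {V : Type*} (G : SimpleGraph V)

/-- An oriented vertex separation `(A, B)` of `G`: `A ∪ B` is the whole vertex set and `G` has
no edge between `A \ B` and `B \ A`. -/
@[ext] structure VSep where
  A : Set V
  B : Set V
  union_eq : A ∪ B = Set.univ
  no_edge : ∀ a ∈ A \ B, ∀ b ∈ B \ A, ¬ G.Adj a b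

variable {G}

/-- `(A, B) ≤ (C, D)` if and only if `A ⊆ C` and `B ⊇ D`. -/
instance : PartialOrder (VSep G) where
  le r s := r.A ⊆ s.A ∧ s.B ⊆ r.B
  le_refl _ := ⟨subset_rfl, subset_rfl⟩
  le_trans _ _ _ h h' := ⟨h.1.trans h'.1, h'.2.trans h.2⟩
  le_antisymm _ _ h h' := VSep.ext (h.1.antisymm h'.1) (h'.2.antisymm h.2)

/-- The inverse of `(A, B)` is `(B, A)`. -/
def VSep.flip (s : VSep G) : VSep G where
  A := s.B
  B := s.A
  union_eq := by rw [Set.union_comm, s.union_eq]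
  no_edge := fun a ha b hb h => s.no_edge b hb a ha h.symm

instance : SepSystem (VSep G) where
  inv := VSep.flip
  inv_inv _ := rfl
  inv_le_inv _ _ h := ⟨h.2, h.1⟩

/-- The order `|A ∩ B|` of a separation `(A, B)` (used for finite graphs only). -/
noncomputable def VSep.order (s : VSep G) : ℕ := (s.A ∩ s.B).ncard

variable (G)

/-- The set of all oriented separations of `G` of order less than `k`. -/
def sepsBelow (k : ℕ) : Set (VSep G) := {s | s.order < k}

/-- The set `F` of all sets `{(A₁, B₁), (A₂, B₂), (A₃, B₃)}` of not necessarily distinct oriented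
separations of order less than `k` such that `G[A₁] ∪ G[A₂] ∪ G[A₃] = G`. -/
def tangleF (k : ℕ) : Set (Set (VSep G)) :=
  {σ | ∃ s₁ ∈ sepsBelow G k, ∃ s₂ ∈ sepsBelow G k, ∃ s₃ ∈ sepsBelow G k, σ = {s₁, s₂, s₃} ∧
    (⊤ : G.Subgraph).induce s₁.A ⊔ (⊤ : G.Subgraph).induce s₂.A ⊔ (⊤ : G.Subgraph).induce s₃.A
      = ⊤}

/-- The set `F*` of those elements of `F` that are stars. -/
def tangleFStar (k : ℕ) : Set (Set (VSep G)) :=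
  {σ | σ ∈ tangleF G k ∧ IsSepStar σ}

/-- A tangle of order `k` in `G`: an orientation of the set of separations of order less than `k`
such that no three of its elements have first sides that together induce all of `G`. -/
def IsTangle (k : ℕ) (O : Set (VSep G)) : Prop :=
  IsOrientation (sepsBelow G k) O ∧ Avoids (tangleF G k) O

/-! ### Branch-width -/

/-- A branch-decomposition of `G`: a finite ternary tree `T` (each node has degree 1 or 3)
together with a bijection `L` from the edges of `G` to the leaves of `T`. -/
structure BranchDecomposition where
  Node : Type
  finite_node : Finite Node
  T : SimpleGraph Node
  isTree : T.IsTree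
  ternary : ∀ t, (T.neighborSet t).ncard = 1 ∨ (T.neighborSet t).ncard = 3
  L : G.edgeSet ≃ {t : Node // (T.neighborSet t).ncard = 1}

variable {G}

/-- The component of `T - e` that contains the initial node of the oriented edge `e`. -/
def BranchDecomposition.side (X : BranchDecomposition G) (e : X.T.Dart) : Set X.Node :=
  {t | (X.T.deleteEdges {e.edge}).Reachable e.fst t}

/-- The vertices of `G` that are incident with an edge mapped by `L` to the component of `T - e`
containing the initial node of `e`. -/
def BranchDecomposition.sideVerts (X : BranchDecomposition G) (e : X.T.Dart) : Set V :=
  {v | ∃ f : G.edgeSet, v ∈ f.1 ∧ (X.L f).1 ∈ X.side e}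

/-- The order of an edge of `T`: the number of vertices of `G` that are incident with edges of `G`
on both sides. -/
noncomputable def BranchDecomposition.edgeOrder (X : BranchDecomposition G) (e : X.T.Dart) : ℕ :=
  (X.sideVerts e ∩ X.sideVerts e.symm).ncard

/-- The width of a branch-decomposition: the maximum order of the edges of its tree. -/
noncomputable def BranchDecomposition.width (X : BranchDecomposition G) : ℕ :=
  ⨆ e : X.T.Dart, X.edgeOrder e

variable (G)

open Classical in
/-- The branch-width of a finite graph: the least width of its branch-decompositions if it has at
least two edges, and `0` otherwise. -/
noncomputable def branchWidth : ℕ :=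
  if G.edgeSet.ncard ≤ 1 then 0
  else sInf (Set.range (BranchDecomposition.width : BranchDecomposition G → ℕ))

/-- `G` is a disjoint union of stars and isolated vertices. An isolated vertex is a star graph
with one vertex. -/
def IsStarForest : Prop :=
  ∀ C : G.ConnectedComponent, ∃ c : C, C.toSimpleGraph = SimpleGraph.starGraph c

end Graph

end TangleDuality

/-!
Call a separation forced if it can be derived from `⊥ = (∅, V)` by the rule that, for a star
`{x, y, z}` in `F*`, the inverse of `x` is forced once `y` and `z` are. Everything depends on
whether `⊤ = (V, ∅)` is forced.

If it is not, take a maximal down-closed set `P` of separations of order less than `k` that contains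
the small ones and from which `⊤` still cannot be derived. If `r` is minimal outside `P`, rerooting
a derivation of `⊤` from `P` and `r` derives the inverse of `r` from `P`, and by submodularity such
a derivation can be shifted to the separations of minimum order above `r`. So `P` orients every
separation. Three separations in `P` that cover `G` could be uncrossed to a star, again by
submodularity; so `P` is a tangle.

If `⊤` is forced, its derivation is an `S_k`-tree over `F*`. For `k ≥ 3`, distributing the edges of
`G` over the leaves of the derivation gives a branch-decomposition of width less than `k`.

Conversely, orienting the edges of a finite tree always produces a sink. An `F*`-tangle orients the
edges of an `S_k`-tree, and a tangle those of a branch-decomposition of width less than `k`; at a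
sink it would contain a forbidden star, or three separations that cover all edges of `G`.

For `k = 1` any vertex defines a tangle, and for `k = 2` any edge does, so that only the presence
of edges matters.
-/

namespace TangleDuality

section Orientations

variable {U : Type*} [SepSystem U] {S O : Set U}

theorem isOrientation_iff : IsOrientation S O ↔ O ⊆ S ∧ ∀ s ∈ S,
    (s ∈ O ∨ SepSystem.inv s ∈ O) ∧ (s ∈ O → SepSystem.inv s ∈ O → s = SepSystem.inv s) := by
  refine and_congr_right fun _ => forall₂_congr fun s _ => ?_
  change (∃! x, (x = s ∨ x = SepSystem.inv s) ∧ x ∈ O) ↔ _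
  constructor
  · rintro ⟨x, ⟨rfl | rfl, hx⟩, h_unique⟩
    · exact ⟨.inl hx, fun _ h => (h_unique _ ⟨.inr rfl, h⟩).symm⟩
    · exact ⟨.inr hx, fun h _ => h_unique _ ⟨.inl rfl, h⟩⟩
  · rintro ⟨h | h, h_eq⟩
    · refine ⟨s, ⟨.inl rfl, h⟩, ?_⟩
      rintro _ ⟨rfl | rfl, h'⟩
      exacts [rfl, (h_eq h h').symm]
    · refine ⟨SepSystem.inv s, ⟨.inr rfl, h⟩, ?_⟩
      rintro _ ⟨rfl | rfl, h'⟩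
      exacts [h_eq h' h, rfl]

theorem IsOrientation.mem_or_inv_mem (hO : IsOrientation S O) {s : U} (hs : s ∈ S) :
    s ∈ O ∨ SepSystem.inv s ∈ O :=
  ((isOrientation_iff.1 hO).2 s hs).1

theorem exists_forall_adj_of_isTree {N : Type*} [Finite N] {T : SimpleGraph N} (hT : T.IsTree)
    {P : N → N → Prop} (hP : ∀ x y, T.Adj x y → P x y ∨ P y x) :
    ∃ t, ∀ x, T.Adj x t → P x t := by
  classical
  have := Fintype.ofFinite N
  by_contra! h
  choose next h_adj h_not using h
  have h_maps : ∀ t ∈ Finset.univ, s(next t, t) ∈ T.edgeFinset := fun t _ => by simpa using h_adj t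
  -- A finite tree has fewer edges than nodes, so two nodes `x`, `y` choose the same edge.
  obtain ⟨x, -, y, -, hxy, h_edge⟩ :=
    Finset.exists_ne_map_eq_of_card_lt_of_maps_to
      (by have := hT.card_edgeFinset; rw [Finset.card_univ]; omega) h_maps
  obtain ⟨-, h⟩ | ⟨hx, hy⟩ := Sym2.eq_iff.1 h_edge
  · exact hxy h
  · have hx' := h_not x
    have hy' := h_not y
    rw [hx] at hx'
    rw [← hy] at hy'
    exact (hP x y (hy ▸ (h_adj y))).elim hy' hx'

theorem IsOrientation.not_isOver (hO : IsOrientation S O) {F : Set (Set U)} (hF : Avoids F O)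
    (X : STree S) : ¬ X.IsOver F := by
  intro hX
  have := X.finite_node
  obtain ⟨t, ht⟩ := exists_forall_adj_of_isTree X.isTree
    (P := fun x y => ∃ h : X.T.Adj x y, X.α ⟨(x, y), h⟩ ∈ O) fun x y h => by
      refine (hO.mem_or_inv_mem (X.α_mem ⟨(x, y), h⟩)).imp (fun hα => ⟨h, hα⟩) fun hα => ?_
      exact ⟨h.symm, by rwa [← X.α_symm ⟨(x, y), h⟩] at hα⟩
  refine hF _ (hX t) ?_
  rintro _ ⟨⟨⟨x, _⟩, h⟩, rfl, rfl⟩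
  exact (ht x h).2

end Orientations

section Cells

variable {V : Type*} {G : SimpleGraph V} {W : Set V}

variable (G) in
/-- A cell of `G` is the vertex set of a vertex or of an edge of `G`. The vertex sets `A` that
cover all cells are those whose induced subgraphs `G[A]` have union `G`. -/
def IsCell (W : Set V) : Prop :=
  ∃ u v, (u = v ∨ G.Adj u v) ∧ W = {u, v}

theorem IsCell.singleton (v : V) : IsCell G {v} :=
  ⟨v, v, .inl rfl, (Set.pair_eq_singleton v).symm⟩

theorem isCell_pair {u v : V} (h : G.Adj u v) : IsCell G {u, v} :=
  ⟨u, v, .inr h, rfl⟩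

theorem isCell_of_mem_edgeSet {f : Sym2 V} (hf : f ∈ G.edgeSet) : IsCell G (f : Set V) := by
  induction f with
  | _ u v => exact ⟨u, v, .inr hf, Sym2.coe_mk⟩

theorem IsCell.eq_or_adj (hW : IsCell G W) {u v : V} (hu : u ∈ W) (hv : v ∈ W) :
    u = v ∨ G.Adj u v := by
  obtain ⟨x, y, h, rfl⟩ := hW
  rcases hu with rfl | rfl <;> rcases hv with rfl | rfl
  exacts [.inl rfl, h, h.imp Eq.symm SimpleGraph.Adj.symm, .inl rfl]

end Cells

namespace VSep

variable {V : Type*} {G : SimpleGraph V} {k : ℕ} {W : Set V}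

theorem mem_or (s : VSep G) (v : V) : v ∈ s.A ∨ v ∈ s.B :=
  s.union_eq.ge (Set.mem_univ v)

theorem subset_or (s : VSep G) (hW : IsCell G W) : W ⊆ s.A ∨ W ⊆ s.B := by
  by_contra! h
  obtain ⟨a, ha, haA⟩ := Set.not_subset.1 h.1
  obtain ⟨b, hb, hbB⟩ := Set.not_subset.1 h.2
  have haB := (s.mem_or a).resolve_left haA
  have hbA := (s.mem_or b).resolve_right hbB
  obtain rfl | hab := hW.eq_or_adj hb ha
  · exact haA hbA
  · exact s.no_edge b ⟨hbA, hbB⟩ a ⟨haB, haA⟩ hab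

/-- The separation with given sides, for sides that cover all cells of the graph. -/
@[simps]
def ofCells (A B : Set V) (h : ∀ W, IsCell G W → W ⊆ A ∨ W ⊆ B) : VSep G where
  A := A
  B := B
  union_eq := Set.eq_univ_of_forall fun v => by simpa using h _ (.singleton v)
  no_edge a ha b hb hab :=
    (h _ (isCell_pair hab)).elim (fun h => hb.2 (h (by simp))) fun h => ha.2 (h (by simp))

instance : Lattice (VSep G) where
  inf r s := ofCells (r.A ∩ s.A) (r.B ∪ s.B) fun _ hW => by
    rcases r.subset_or hW with hr | hr
    · exact (s.subset_or hW).imp (Set.subset_inter hr) (Set.subset_union_of_subset_right · _)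
    · exact .inr (Set.subset_union_of_subset_left hr _)
  sup r s := ofCells (r.A ∪ s.A) (r.B ∩ s.B) fun _ hW => by
    rcases r.subset_or hW with hr | hr
    · exact .inl (Set.subset_union_of_subset_left hr _)
    · exact (s.subset_or hW).imp (Set.subset_union_of_subset_right · _)
        (Set.subset_inter hr)
  inf_le_left _ _ := ⟨Set.inter_subset_left, Set.subset_union_left⟩
  inf_le_right _ _ := ⟨Set.inter_subset_right, Set.subset_union_right⟩
  le_inf _ _ _ h h' := ⟨Set.subset_inter h.1 h'.1, Set.union_subset h.2 h'.2⟩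
  le_sup_left _ _ := ⟨Set.subset_union_left, Set.inter_subset_left⟩
  le_sup_right _ _ := ⟨Set.subset_union_right, Set.inter_subset_right⟩
  sup_le _ _ _ h h' := ⟨Set.union_subset h.1 h'.1, Set.subset_inter h.2 h'.2⟩

instance : BoundedOrder (VSep G) where
  top := ofCells Set.univ ∅ fun W _ => .inl (Set.subset_univ W)
  bot := ofCells ∅ Set.univ fun W _ => .inr (Set.subset_univ W)
  le_top _ := ⟨Set.subset_univ _, Set.empty_subset _⟩
  bot_le _ := ⟨Set.empty_subset _, Set.subset_univ _⟩

instance [Finite V] : Finite (VSep G) :=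
  Finite.of_injective (fun s : VSep G => (s.A, s.B)) fun _ _ h =>
    VSep.ext (congrArg Prod.fst h) (congrArg Prod.snd h)

variable {r s : VSep G}

@[simp] theorem inf_A : (r ⊓ s).A = r.A ∩ s.A := rfl

@[simp] theorem inf_B : (r ⊓ s).B = r.B ∪ s.B := rfl

@[simp] theorem sup_A : (r ⊔ s).A = r.A ∪ s.A := rfl

@[simp] theorem sup_B : (r ⊔ s).B = r.B ∩ s.B := rfl

@[simp] theorem bot_A : (⊥ : VSep G).A = ∅ := rfl

@[simp] theorem flip_flip : s.flip.flip = s := rfl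

@[simp] theorem flip_bot : (⊥ : VSep G).flip = ⊤ := rfl

theorem flip_sup : (r ⊔ s).flip = r.flip ⊓ s.flip := rfl

theorem le_flip_comm : r ≤ s.flip ↔ s ≤ r.flip :=
  and_comm

@[simp] theorem flip_le_flip : r.flip ≤ s.flip ↔ s ≤ r :=
  le_flip_comm

@[simp] theorem order_flip : s.flip.order = s.order :=
  congrArg Set.ncard (Set.inter_comm _ _)

@[simp] theorem order_bot : (⊥ : VSep G).order = 0 := by
  simp [order]

theorem order_inf_add_order_sup_le [Finite V] (r s : VSep G) :
    (r ⊓ s).order + (r ⊔ s).order ≤ r.order + s.order := by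
  simp only [order, inf_A, inf_B, sup_A, sup_B]
  rw [← Set.ncard_union_add_ncard_inter (r.A ∩ r.B), ← Set.ncard_union_add_ncard_inter (_ ∩ _ ∩ _)]
  refine add_le_add (Set.ncard_le_ncard fun v => ?_) (Set.ncard_le_ncard fun v => ?_) <;>
    simp only [Set.mem_union, Set.mem_inter_iff] <;> grind [mem_or]

theorem flip_mem_sepsBelow : s.flip ∈ sepsBelow G k ↔ s ∈ sepsBelow G k := by
  simp only [sepsBelow, Set.mem_ofPred_eq, order_flip]

theorem bot_mem_sepsBelow (hk : 0 < k) : ⊥ ∈ sepsBelow G k := by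
  simpa only [sepsBelow, Set.mem_ofPred_eq, order_bot]

end VSep

section Covers

variable {V : Type*} {G : SimpleGraph V} {r s t : VSep G}

/-- Three separations cover `G` if every vertex and every edge of `G` lies in one of their first
sides; see `covers_iff`. -/
def Covers (r s t : VSep G) : Prop :=
  ∀ W, IsCell G W → W ⊆ r.A ∨ W ⊆ s.A ∨ W ⊆ t.A

theorem covers_iff : Covers r s t ↔
    (⊤ : G.Subgraph).induce r.A ⊔ (⊤ : G.Subgraph).induce s.A ⊔ (⊤ : G.Subgraph).induce t.A
      = ⊤ := by
  constructor
  · intro h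
    ext u v
    · simpa [or_assoc] using h _ (.singleton u)
    · have := fun huv : G.Adj u v => h _ (isCell_pair huv)
      simp only [Set.pair_subset_iff] at this
      simp only [SimpleGraph.Subgraph.sup_adj, SimpleGraph.Subgraph.induce_adj,
        SimpleGraph.Subgraph.top_adj]
      tauto
  · rintro h _ ⟨u, v, rfl | huv, rfl⟩
    · have hu : u ∈ (⊤ : G.Subgraph).verts := trivial
      rw [← h] at hu
      simpa [or_assoc] using hu
    · have huv' : (⊤ : G.Subgraph).Adj u v := huv
      rw [← h] at huv'
      simp only [SimpleGraph.Subgraph.sup_adj, SimpleGraph.Subgraph.induce_adj] at huv'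
      simp only [Set.pair_subset_iff]
      tauto

theorem Covers.rotate (h : Covers r s t) : Covers s t r :=
  fun W hW => or_rotate.1 (h W hW)

theorem Covers.swap (h : Covers r s t) : Covers r t s :=
  fun W hW => (h W hW).imp_right Or.symm

theorem covers_flip_flip (s : VSep G) : Covers s s.flip s.flip :=
  fun _ hW => (s.subset_or hW).imp_right .inl

end Covers

section Tangles

variable {V : Type*} {G : SimpleGraph V} {k : ℕ} {O : Set (VSep G)} {r s t : VSep G}

theorem mem_tangleF (hr : r ∈ sepsBelow G k) (hs : s ∈ sepsBelow G k) (ht : t ∈ sepsBelow G k)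
    (h : Covers r s t) : {r, s, t} ∈ tangleF G k :=
  ⟨r, hr, s, hs, t, ht, rfl, covers_iff.1 h⟩

theorem avoids_tangleF_iff (hO : O ⊆ sepsBelow G k) :
    Avoids (tangleF G k) O ↔ ∀ r ∈ O, ∀ s ∈ O, ∀ t ∈ O, ¬ Covers r s t := by
  constructor
  · intro h r hr s hs t ht hc
    refine h _ (mem_tangleF (hO hr) (hO hs) (hO ht) hc) ?_
    rintro _ (rfl | rfl | rfl) <;> assumption
  · rintro h _ ⟨r, -, s, -, t, -, rfl, hc⟩ hσ
    exact h r (hσ (by simp)) s (hσ (by simp)) t (hσ (by simp)) (covers_iff.2 hc)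

theorem isTangle_iff : IsTangle G k O ↔ O ⊆ sepsBelow G k ∧
    (∀ s ∈ sepsBelow G k, s ∈ O ∨ s.flip ∈ O) ∧
      ∀ r ∈ O, ∀ s ∈ O, ∀ t ∈ O, ¬ Covers r s t := by
  constructor
  · intro h
    exact ⟨h.1.1, fun s hs => h.1.mem_or_inv_mem hs, (avoids_tangleF_iff h.1.1).1 h.2⟩
  · rintro ⟨h_sub, h_or, h_cov⟩
    refine ⟨isOrientation_iff.2 ⟨h_sub, fun s hs => ⟨h_or s hs, fun h h' => ?_⟩⟩,
      (avoids_tangleF_iff h_sub).2 h_cov⟩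
    exact absurd (covers_flip_flip s) (h_cov s h _ h' _ h')

namespace IsTangle

theorem subset (hO : IsTangle G k O) : O ⊆ sepsBelow G k :=
  (isTangle_iff.1 hO).1

theorem mem_or (hO : IsTangle G k O) (hs : s ∈ sepsBelow G k) : s ∈ O ∨ s.flip ∈ O :=
  (isTangle_iff.1 hO).2.1 s hs

theorem not_covers (hO : IsTangle G k O) (hr : r ∈ O) (hs : s ∈ O) (ht : t ∈ O) :
    ¬ Covers r s t :=
  (isTangle_iff.1 hO).2.2 r hr s hs t ht

theorem mem_of_le (hO : IsTangle G k O) (hs : s ∈ O) (hr : r ∈ sepsBelow G k) (hrs : r ≤ s) :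
    r ∈ O :=
  (hO.mem_or hr).resolve_right fun hr' => hO.not_covers hs hr' hr' fun _ hW =>
    (r.subset_or hW).imp (·.trans hrs.1) .inl

theorem isFTangle (hO : IsTangle G k O) : IsFTangle (sepsBelow G k) (tangleF G k) O where
  orientation := hO.1
  avoids := hO.2
  consistent := by
    rintro ⟨r, hr, s, -, -, hrs, hr', hs⟩
    exact hO.not_covers (hO.mem_of_le hs hr hrs.le) hr' hr' (covers_flip_flip r)

end IsTangle

theorem IsCell.isTangle [Finite V] {W : Set V} (hW : IsCell G W) (hk : k ≤ W.ncard) :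
    IsTangle G k {s ∈ sepsBelow G k | W ⊆ s.B} := by
  have not_subset_A : ∀ s ∈ sepsBelow G k, W ⊆ s.B → ¬ W ⊆ s.A := fun s hs hB hA =>
    (hs.trans_le hk).not_ge (Set.ncard_le_ncard (Set.subset_inter hA hB))
  refine isTangle_iff.2 ⟨Set.sep_subset _ _, fun s hs => ?_, ?_⟩
  · exact (s.subset_or hW).symm.imp (⟨hs, ·⟩) (⟨VSep.flip_mem_sepsBelow.2 hs, ·⟩)
  · rintro r ⟨hr, hr'⟩ s ⟨hs, hs'⟩ t ⟨ht, ht'⟩ hc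
    rcases hc W hW with h | h | h
    exacts [not_subset_A r hr hr' h, not_subset_A s hs hs' h, not_subset_A t ht ht' h]

theorem exists_isTangle_one [Finite V] [Nonempty V] : ∃ O, IsTangle G 1 O :=
  ⟨_, (IsCell.singleton (Classical.arbitrary V)).isTangle (Set.ncard_singleton _).ge⟩

end Tangles

section Forcing

variable {V : Type*} {G : SimpleGraph V} {k : ℕ} {P Q : Set (VSep G)} {q r s x y z : VSep G}

/-- The separations `x`, `y`, `z` of order less than `k` point towards each other and cover `G`,
so that `{x, y, z}` is an element of `tangleFStar G k`. -/
structure IsStarCover (k : ℕ) (x y z : VSep G) : Prop where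
  mem₁ : x ∈ sepsBelow G k
  mem₂ : y ∈ sepsBelow G k
  mem₃ : z ∈ sepsBelow G k
  le₁₂ : x ≤ y.flip
  le₁₃ : x ≤ z.flip
  le₂₃ : y ≤ z.flip
  covers : Covers x y z

namespace IsStarCover

theorem rotate (h : IsStarCover k x y z) : IsStarCover k y z x :=
  ⟨h.mem₂, h.mem₃, h.mem₁, h.le₂₃, VSep.le_flip_comm.1 h.le₁₂, VSep.le_flip_comm.1 h.le₁₃,
    h.covers.rotate⟩

theorem swap (h : IsStarCover k x y z) : IsStarCover k x z y :=
  ⟨h.mem₁, h.mem₃, h.mem₂, h.le₁₃, h.le₁₂, VSep.le_flip_comm.1 h.le₂₃, h.covers.swap⟩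

theorem mem_tangleFStar (h : IsStarCover k x y z) : {x, y, z} ∈ tangleFStar G k := by
  refine ⟨mem_tangleF h.mem₁ h.mem₂ h.mem₃ h.covers, Set.insert_nonempty _ _, ?_⟩
  rintro r (rfl | rfl | rfl) s (rfl | rfl | rfl) hrs
  exacts [absurd rfl hrs, h.le₁₂, h.le₁₃, h.rotate.le₁₃, absurd rfl hrs, h.le₂₃,
    h.rotate.rotate.le₁₂, h.rotate.rotate.le₁₃, absurd rfl hrs]

theorem bot (hk : 0 < k) (hs : s ∈ sepsBelow G k) : IsStarCover k ⊥ s s.flip :=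
  ⟨VSep.bot_mem_sepsBelow hk, hs, VSep.flip_mem_sepsBelow.2 hs, bot_le, bot_le, le_rfl,
    fun _ hW => .inr (s.subset_or hW)⟩

theorem flip_bot_bot (hk : 0 < k) (hs : s ∈ sepsBelow G k) (h_small : s ≤ s.flip) :
    IsStarCover k s.flip ⊥ ⊥ :=
  ⟨VSep.flip_mem_sepsBelow.2 hs, VSep.bot_mem_sepsBelow hk, VSep.bot_mem_sepsBelow hk, le_top,
    le_top, bot_le, fun _ hW => .inl ((s.subset_or hW).elim (·.trans h_small.1) id)⟩

theorem shift (h : IsStarCover k x y z) (hx : x ⊔ s.flip ∈ sepsBelow G k)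
    (hy : y ⊓ s ∈ sepsBelow G k) (hz : z ⊓ s ∈ sepsBelow G k) :
    IsStarCover k (x ⊔ s.flip) (y ⊓ s) (z ⊓ s) where
  mem₁ := hx
  mem₂ := hy
  mem₃ := hz
  le₁₂ := sup_le_sup_right h.le₁₂ s.flip
  le₁₃ := sup_le_sup_right h.le₁₃ s.flip
  le₂₃ := inf_le_left.trans (h.le₂₃.trans (VSep.flip_le_flip.2 inf_le_left))
  covers W hW := by
    rcases s.subset_or hW with hs | hs
    · exact (h.covers W hW).imp (Set.subset_union_of_subset_left · _)
        (Or.imp (Set.subset_inter · hs) (Set.subset_inter · hs))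
    · exact .inl (Set.subset_union_of_subset_right hs _)

end IsStarCover

/-- `Forces k P r` says that `r` lies in every orientation of `sepsBelow G k` that contains `P` and
avoids the stars in `tangleFStar G k` for a reason recorded by a derivation tree: if `{x, y, z}` is
such a star and `y`, `z` are forced, then so is the inverse of `x`. -/
inductive Forces (k : ℕ) (P : Set (VSep G)) : VSep G → Prop
  | of_mem {r : VSep G} : r ∈ P → Forces k P r
  | of_star {x y z : VSep G} :
      IsStarCover k x y z → Forces k P y → Forces k P z → Forces k P x.flip

namespace Forces

theorem trans (h : Forces k P r) (hPQ : ∀ s ∈ P, Forces k Q s) : Forces k Q r := by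
  induction h with
  | of_mem h => exact hPQ _ h
  | of_star h _ _ ihy ihz => exact .of_star h ihy ihz

theorem mono (h : Forces k P r) (hPQ : P ⊆ Q) : Forces k Q r :=
  h.trans fun _ hs => .of_mem (hPQ hs)

theorem mem_sepsBelow (h : Forces k P r) (hP : P ⊆ sepsBelow G k) : r ∈ sepsBelow G k := by
  cases h with
  | of_mem h => exact hP h
  | of_star h => exact VSep.flip_mem_sepsBelow.2 h.mem₁

theorem top (h : Forces k P s) (h' : Forces k P s.flip) (hk : 0 < k) (hP : P ⊆ sepsBelow G k) :
    Forces k P ⊤ :=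
  .of_star (.bot hk (h.mem_sepsBelow hP)) h h'

theorem of_le_flip (hk : 0 < k) (hs : s ∈ sepsBelow G k) (h_small : s ≤ s.flip) :
    Forces k {⊥} s :=
  .of_star (.flip_bot_bot hk hs h_small) (.of_mem rfl) (.of_mem rfl)

theorem insert_of_isStarCover (h : IsStarCover k x y z) (hr : Forces k (insert y.flip P) r)
    (hz : Forces k P z) : Forces k (insert x P) r := by
  refine hr.trans ?_
  rintro s (rfl | hs)
  · exact .of_star h.rotate.swap (.of_mem (Set.mem_insert x P)) (hz.mono (Set.subset_insert x P))
  · exact .of_mem (.inr hs)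

-- The derivation tree of `y` is rerooted at a leaf labelled `r`. Two such leaves cannot sit below
-- different children of a star, since the star would then make `r` small.
theorem reroot (hr : ¬ r ≤ r.flip) (h : Forces k (insert r P) y) :
    Forces k P y ∨ (r ≤ y ∧ Forces k (insert y.flip P) r.flip) := by
  induction h with
  | of_mem h =>
    rcases h with rfl | h
    · exact .inr ⟨le_rfl, .of_mem (Set.mem_insert _ P)⟩
    · exact .inl (.of_mem h)
  | @of_star x y z h _ _ ihy ihz =>
    rcases ihy with hy | ⟨hry, hy⟩ <;> rcases ihz with hz | ⟨hrz, hz⟩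
    · exact .inl (.of_star h hy hz)
    · exact .inr ⟨hrz.trans h.rotate.rotate.le₁₂, insert_of_isStarCover h.swap hz hy⟩
    · exact .inr ⟨hry.trans h.rotate.le₁₃, insert_of_isStarCover h hy hz⟩
    · exact absurd (hry.trans (h.le₂₃.trans (VSep.flip_le_flip.2 hrz))) hr

end Forces

/-- `P` is a set of separations of order less than `k` that is closed under taking smaller
separations of order less than `k`. -/
structure IsDownClosed (k : ℕ) (P : Set (VSep G)) : Prop where
  subset : P ⊆ sepsBelow G k
  mem_of_le : ∀ s ∈ P, ∀ r ∈ sepsBelow G k, r ≤ s → r ∈ P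

theorem IsDownClosed.insert (hP : IsDownClosed k P) (hr : Minimal (· ∈ sepsBelow G k \ P) r) :
    IsDownClosed k (insert r P) where
  subset := Set.insert_subset hr.prop.1 hP.subset
  mem_of_le := by
    rintro s (rfl | hs) t ht hts
    · by_contra h
      exact h (.inl (hr.eq_of_le ⟨ht, fun htP => h (.inr htP)⟩ hts))
    · exact .inr (hP.mem_of_le s hs t ht hts)

theorem Forces.inf (h : Forces k P y) (hP : IsDownClosed k P)
    (hs : ∀ t ∈ sepsBelow G k, t ≤ q → t ⊓ s ∈ sepsBelow G k) (hy : y ≤ q) :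
    Forces k P (y ⊓ s) := by
  induction h with
  | of_mem h => exact .of_mem (hP.mem_of_le _ h _ (hs _ (hP.subset h) hy) inf_le_left)
  | @of_star x y z h _ _ ihy ihz =>
    have hyq := h.rotate.le₁₃.trans hy
    have hzq := h.rotate.rotate.le₁₂.trans hy
    have hxs := VSep.flip_mem_sepsBelow.2 (hs _ (VSep.flip_mem_sepsBelow.2 h.mem₁) hy)
    exact .of_star (h.shift hxs (hs y h.mem₂ hyq) (hs z h.mem₃ hzq)) (ihy hyq) (ihz hzq)

theorem Forces.flip_of_minimal_order [Finite V] (h : Forces k P r.flip) (hP : IsDownClosed k P)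
    (hrx : r ≤ x) (hxq : x ≤ q) (h_min : ∀ y, r ≤ y → y ≤ q → x.order ≤ y.order) :
    Forces k P x.flip := by
  rw [← inf_eq_right.2 (VSep.flip_le_flip.2 hrx)]
  refine h.inf hP (fun y hy hyr => ?_) le_rfl
  have h_sub := VSep.order_inf_add_order_sup_le y x.flip
  have h_link : x.order ≤ (y ⊔ x.flip).order := by
    rw [← VSep.order_flip (s := y ⊔ x.flip), VSep.flip_sup, VSep.flip_flip]
    exact h_min _ (le_inf (VSep.le_flip_comm.1 hyr) hrx) (inf_le_right.trans hxq)
  have hyk : y.order < k := hy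
  rw [VSep.order_flip] at h_sub
  change _ < k
  omega

end Forcing

section Uncrossing

variable {V : Type*} {G : SimpleGraph V} {k : ℕ} {P : Set (VSep G)} {r s t : VSep G}

theorem Covers.inf_flip (h : Covers r s t) : Covers (r ⊓ s.flip) s t := fun W hW => by
  rcases s.subset_or hW with hs | hs
  · exact .inr (.inl hs)
  · exact (h W hW).imp_left (Set.subset_inter · hs)

theorem IsDownClosed.inf_flip_mem_or [Finite V] (hP : IsDownClosed k P) (hr : r ∈ P)
    (hs : s ∈ P) : r ⊓ s.flip ∈ P ∨ s ⊓ r.flip ∈ P := by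
  have h_sub := VSep.order_inf_add_order_sup_le r s.flip
  rw [← VSep.order_flip (s := r ⊔ s.flip), VSep.flip_sup, inf_comm r.flip, VSep.flip_flip,
    VSep.order_flip] at h_sub
  have hrk : r.order < k := hP.subset hr
  have hsk : s.order < k := hP.subset hs
  obtain h | h : (r ⊓ s.flip).order < k ∨ (s ⊓ r.flip).order < k := by omega
  · exact .inl (hP.mem_of_le r hr _ h inf_le_left)
  · exact .inr (hP.mem_of_le s hs _ h inf_le_left)

theorem IsDownClosed.le_flip_of_minimal_covers [Finite V] (hP : IsDownClosed k P) (hr : r ∈ P)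
    (hs : s ∈ P) (h : Covers r s t) (hr_min : ∀ r' ∈ P, Covers r' s t → r' ≤ r → r ≤ r')
    (hs_min : ∀ s' ∈ P, Covers r s' t → s' ≤ s → s ≤ s') : r ≤ s.flip := by
  rcases hP.inf_flip_mem_or hr hs with h' | h'
  · exact (hr_min _ h' h.inf_flip inf_le_left).trans inf_le_right
  · have h_cov : Covers r (s ⊓ r.flip) t := h.rotate.swap.inf_flip.rotate.swap
    exact VSep.le_flip_comm.1 ((hs_min _ h' h_cov inf_le_left).trans inf_le_right)

-- A cover that is minimal in each of its elements consists of nested separations.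
theorem IsDownClosed.exists_isStarCover [Finite V] (hP : IsDownClosed k P) (hr : r ∈ P)
    (hs : s ∈ P) (ht : t ∈ P) (h : Covers r s t) :
    ∃ x ∈ P, ∃ y ∈ P, ∃ z ∈ P, IsStarCover k x y z := by
  obtain ⟨⟨x, y, z⟩, -, h_min⟩ := (Set.toFinite {p : VSep G × VSep G × VSep G | p.1 ∈ P ∧
    p.2.1 ∈ P ∧ p.2.2 ∈ P ∧ Covers p.1 p.2.1 p.2.2}).exists_le_minimal
      (a := (r, s, t)) ⟨hr, hs, ht, h⟩
  obtain ⟨hx, hy, hz, h_cov⟩ : x ∈ P ∧ y ∈ P ∧ z ∈ P ∧ Covers x y z := h_min.prop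
  have hx_min : ∀ x' ∈ P, Covers x' y z → x' ≤ x → x ≤ x' := fun x' hx' hc hle =>
    (h_min.le_of_le (y := (x', y, z)) ⟨hx', hy, hz, hc⟩ ⟨hle, le_rfl, le_rfl⟩).1
  have hy_min : ∀ y' ∈ P, Covers x y' z → y' ≤ y → y ≤ y' := fun y' hy' hc hle =>
    (h_min.le_of_le (y := (x, y', z)) ⟨hx, hy', hz, hc⟩ ⟨le_rfl, hle, le_rfl⟩).2.1
  have hz_min : ∀ z' ∈ P, Covers x y z' → z' ≤ z → z ≤ z' := fun z' hz' hc hle =>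
    (h_min.le_of_le (y := (x, y, z')) ⟨hx, hy, hz', hc⟩ ⟨le_rfl, le_rfl, hle⟩).2.2
  refine ⟨x, hx, y, hy, z, hz, hP.subset hx, hP.subset hy, hP.subset hz, ?_, ?_, ?_, h_cov⟩
  · exact hP.le_flip_of_minimal_covers hx hy h_cov hx_min hy_min
  · exact hP.le_flip_of_minimal_covers hx hz h_cov.swap (fun x' hx' hc => hx_min x' hx' hc.swap)
      fun z' hz' hc => hz_min z' hz' hc.swap
  · exact hP.le_flip_of_minimal_covers hy hz h_cov.rotate
      (fun y' hy' hc => hy_min y' hy' hc.rotate.rotate)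
      fun z' hz' hc => hz_min z' hz' hc.rotate.rotate

end Uncrossing

section Pretangles

variable {V : Type*} {G : SimpleGraph V} {k : ℕ} {P : Set (VSep G)} {r s : VSep G}

/-- A pretangle is a down-closed set of separations that contains the small ones and does not force
the greatest separation. The maximal pretangles are tangles. -/
structure IsPretangle (k : ℕ) (P : Set (VSep G)) : Prop extends IsDownClosed k P where
  mem_of_le_flip : ∀ s ∈ sepsBelow G k, s ≤ s.flip → s ∈ P
  not_forces_top : ¬ Forces k P ⊤

theorem IsPretangle.forces_flip_of_minimal (hP : Maximal (IsPretangle k) P) (hk : 0 < k)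
    (hr : Minimal (· ∈ sepsBelow G k \ P) r) : Forces k P r.flip := by
  have h_top : Forces k (insert r P) ⊤ := by
    by_contra h
    exact hr.prop.2 (hP.le_of_ge (y := insert r P) ⟨hP.prop.toIsDownClosed.insert hr,
      fun s hs hs' => .inr (hP.prop.mem_of_le_flip s hs hs'), h⟩ (Set.subset_insert r P) (.inl rfl))
  have hr_small : ¬ r ≤ r.flip := fun h => hr.prop.2 (hP.prop.mem_of_le_flip r hr.prop.1 h)
  have h_bot : ⊥ ∈ P := hP.prop.mem_of_le_flip ⊥ (VSep.bot_mem_sepsBelow hk) bot_le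
  have h_flip := ((h_top.reroot hr_small).resolve_left hP.prop.not_forces_top).2
  rwa [← VSep.flip_bot, VSep.flip_flip, Set.insert_eq_of_mem h_bot] at h_flip

-- If `P` contained neither `s` nor its inverse, it would force both orientations of a separation of
-- minimum order between minimal separations below `s` and below its inverse that are not in `P`.
theorem IsPretangle.mem_or [Finite V] (hP : Maximal (IsPretangle k) P) (hk : 0 < k)
    (hs : s ∈ sepsBelow G k) : s ∈ P ∨ s.flip ∈ P := by
  by_contra! h
  obtain ⟨q, hqs, hq⟩ := (Set.toFinite (sepsBelow G k \ P)).exists_le_minimal ⟨hs, h.1⟩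
  obtain ⟨r, hrs, hr⟩ := (Set.toFinite (sepsBelow G k \ P)).exists_le_minimal
    ⟨VSep.flip_mem_sepsBelow.2 hs, h.2⟩
  obtain ⟨x, ⟨hqx, hxr⟩, hx⟩ := Set.exists_min_image (Set.Icc q r.flip) VSep.order
    (Set.toFinite _) ⟨s, hqs, VSep.le_flip_comm.1 hrs⟩
  have hx_flip : Forces k P x.flip :=
    (forces_flip_of_minimal hP hk hq).flip_of_minimal_order hP.prop.toIsDownClosed hqx hxr
      fun y hqy hyr => hx y ⟨hqy, hyr⟩
  have hx_self : Forces k P x.flip.flip :=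
    (forces_flip_of_minimal hP hk hr).flip_of_minimal_order hP.prop.toIsDownClosed
      (VSep.le_flip_comm.1 hxr) (VSep.flip_le_flip.2 hqx) fun y hry hyq => by
        rw [VSep.order_flip, ← VSep.order_flip (s := y)]
        exact hx y.flip ⟨VSep.le_flip_comm.1 hyq, VSep.flip_le_flip.2 hry⟩
  exact hP.prop.not_forces_top (hx_flip.top hx_self hk hP.prop.subset)

theorem IsPretangle.isTangle [Finite V] (hP : Maximal (IsPretangle k) P) (hk : 0 < k) :
    IsTangle G k P := by
  refine isTangle_iff.2 ⟨hP.prop.subset, fun s hs => mem_or hP hk hs, fun r hr s hs t ht h => ?_⟩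
  obtain ⟨x, hx, y, hy, z, hz, h_star⟩ := hP.prop.exists_isStarCover hr hs ht h
  have hx_flip : Forces k P x.flip := .of_star h_star (.of_mem hy) (.of_mem hz)
  exact hP.prop.not_forces_top (Forces.top (.of_mem hx) hx_flip hk hP.prop.subset)

theorem isPretangle_small (hk : 0 < k) (h : ¬ Forces k {⊥} (⊤ : VSep G)) :
    IsPretangle k {s ∈ sepsBelow G k | s ≤ s.flip} where
  subset := Set.sep_subset _ _
  mem_of_le := fun _ hs _ hr hrs => ⟨hr, (hrs.trans hs.2).trans (VSep.flip_le_flip.2 hrs)⟩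
  mem_of_le_flip := fun _ hs h_small => ⟨hs, h_small⟩
  not_forces_top := fun h' => h (h'.trans fun _ hs => .of_le_flip hk hs.1 hs.2)

theorem forces_top_of_not_exists_isTangle [Finite V] (hk : 0 < k) (h : ¬ ∃ O, IsTangle G k O) :
    Forces k {⊥} (⊤ : VSep G) := by
  by_contra h_top
  obtain ⟨P, -, hP⟩ := (Set.toFinite {P : Set (VSep G) | IsPretangle k P}).exists_le_maximal
    (isPretangle_small hk h_top)
  exact h ⟨P, IsPretangle.isTangle hP hk⟩

end Pretangles

section LabelledTrees

open SimpleGraph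

/-- A finite tree whose oriented edges are labelled by elements of `S` so that reversing an edge
applies `inv` to its label. The values of `α` at non-adjacent nodes are irrelevant. -/
structure LabelledTree {Λ : Type*} (inv : Λ → Λ) (S : Set Λ) where
  Node : Type
  [finite_node : Finite Node]
  T : SimpleGraph Node
  isTree : T.IsTree
  α : Node → Node → Λ
  α_mem : ∀ x y, T.Adj x y → α x y ∈ S
  α_symm : ∀ x y, T.Adj x y → α y x = inv (α x y)

attribute [instance] LabelledTree.finite_node

/-- The disjoint union of two graphs with an additional edge from `a` to `b`. -/
abbrev joinGraph {M N : Type*} (T : SimpleGraph M) (T' : SimpleGraph N) (a : M) (b : N) :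
    SimpleGraph (M ⊕ N) :=
  (T ⊕g T') ⊔ edge (.inl a) (.inr b)

theorem isTree_joinGraph {M N : Type*} [Finite M] [Finite N] {T : SimpleGraph M}
    {T' : SimpleGraph N} (hT : T.IsTree) (hT' : T'.IsTree) (a : M) (b : N) :
    (joinGraph T T' a b).IsTree := by
  have h_conn : (joinGraph T T' a b).Connected := hT.connected.sum_sup_edge hT'.connected
  have h_sum : (T ⊕g T').edgeSet.ncard = T.edgeSet.ncard + T'.edgeSet.ncard := by
    simp only [← Nat.card_coe_set_eq, Nat.card_congr edgeSetSumEquiv, Nat.card_sum]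
  have h_join : (joinGraph T T' a b).edgeSet.ncard ≤ (T ⊕g T').edgeSet.ncard + 1 := by
    rw [edgeSet_sup, edgeSet_edge_of_ne Sum.inl_ne_inr]
    exact (Set.ncard_union_le _ _).trans_eq (by rw [Set.ncard_singleton])
  rw [isTree_iff_connected_and_card, Nat.card_coe_set_eq] at hT hT' ⊢
  refine ⟨h_conn, le_antisymm ?_ h_conn.card_vert_le_card_edgeSet_add_one⟩
  rw [Nat.card_sum, ← hT.2, ← hT'.2]
  omega

namespace LabelledTree

variable {Λ : Type*} {inv : Λ → Λ} {S : Set Λ}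

/-- The labels of the edges towards `t`, with multiplicities. -/
noncomputable def incoming (X : LabelledTree inv S) (t : X.Node) : Multiset Λ :=
  (X.T.neighborSet t).toFinite.toFinset.val.map (X.α · t)

theorem mem_incoming (X : LabelledTree inv S) {t : X.Node} {l : Λ} :
    l ∈ X.incoming t ↔ ∃ x, X.T.Adj x t ∧ X.α x t = l := by
  simp [incoming, X.T.adj_comm]

theorem card_incoming (X : LabelledTree inv S) (t : X.Node) :
    (X.incoming t).card = (X.T.neighborSet t).ncard := by
  rw [incoming, Multiset.card_map, Set.ncard_eq_toFinset_card, Finset.card]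

/-- The tree obtained from `X` and `Y` by joining the node `b` of `Y` to the node `a` of `X` by an
edge labelled `l` in the direction from `b` to `a`. -/
abbrev join (X Y : LabelledTree inv S) (a : X.Node) (b : Y.Node) {l : Λ} (hl : l ∈ S)
    (hl' : inv l ∈ S) (h_inv : inv (inv l) = l) : LabelledTree inv S where
  Node := X.Node ⊕ Y.Node
  T := joinGraph X.T Y.T a b
  isTree := isTree_joinGraph X.isTree Y.isTree a b
  α
    | .inl x, .inl y => X.α x y
    | .inr x, .inr y => Y.α x y
    | .inl _, .inr _ => inv l
    | .inr _, .inl _ => l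
  α_mem := by
    rintro (x | x) (y | y) h
    exacts [X.α_mem x y (by simpa [edge_adj] using h), hl', hl,
      Y.α_mem x y (by simpa [edge_adj] using h)]
  α_symm := by
    rintro (x | x) (y | y) h
    exacts [X.α_symm x y (by simpa [edge_adj] using h), h_inv.symm, rfl,
      Y.α_symm x y (by simpa [edge_adj] using h)]

variable (X Y : LabelledTree inv S) (a : X.Node) (b : Y.Node) {l : Λ} (hl : l ∈ S)
  (hl' : inv l ∈ S) (h_inv : inv (inv l) = l)

open Classical in
theorem incoming_join_inl (t : X.Node) : (X.join Y a b hl hl' h_inv).incoming (.inl t) =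
    X.incoming t + if t = a then {l} else 0 := by
  have h : ((joinGraph X.T Y.T a b).neighborSet (.inl t)).toFinite.toFinset =
      (X.T.neighborSet t).toFinite.toFinset.disjSum (if t = a then {b} else ∅) := by
    ext (x | x) <;> split_ifs with ht <;> simp [edge_adj, ht, Ne.symm]
  rw [incoming, h, Finset.val_disjSum, Multiset.map_disjSum]
  split_ifs <;> simp [incoming]

open Classical in
theorem incoming_join_inr (t : Y.Node) : (X.join Y a b hl hl' h_inv).incoming (.inr t) =
    (if t = b then {inv l} else 0) + Y.incoming t := by
  have h : ((joinGraph X.T Y.T a b).neighborSet (.inr t)).toFinite.toFinset =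
      (if t = b then {a} else ∅ : Finset X.Node).disjSum
        (Y.T.neighborSet t).toFinite.toFinset := by
    ext (x | x) <;> split_ifs with ht <;> simp [edge_adj, ht, Ne.symm]
  rw [incoming, h, Finset.val_disjSum, Multiset.map_disjSum]
  split_ifs <;> simp [incoming]

/-- The `S`-tree given by a labelled tree with an edge. -/
def toSTree {U : Type*} [SepSystem U] {S : Set U} (X : LabelledTree SepSystem.inv S)
    (h : Nonempty X.T.Dart) : STree S where
  Node := X.Node
  finite_node := inferInstance
  T := X.T
  isTree := X.isTree
  nonempty_dart := h
  α e := X.α e.fst e.snd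
  α_mem e := X.α_mem _ _ e.adj
  α_symm e := X.α_symm _ _ e.adj

theorem starAt_toSTree {U : Type*} [SepSystem U] {S : Set U} (X : LabelledTree SepSystem.inv S)
    (h : Nonempty X.T.Dart) (t : X.Node) : (X.toSTree h).starAt t = {s | s ∈ X.incoming t} := by
  ext s
  rw [Set.mem_ofPred_eq, X.mem_incoming]
  constructor
  · rintro ⟨e, rfl, rfl⟩
    exact ⟨e.fst, e.adj, rfl⟩
  · rintro ⟨x, hx, rfl⟩
    exact ⟨⟨(x, t), hx⟩, rfl, rfl⟩

end LabelledTree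

section Branches

variable {Λ : Type*} {inv : Λ → Λ} {S : Set Λ} {𝓜 : Set (Multiset Λ)} {M : Multiset Λ} {l : Λ}

/-- There is a labelled tree with a root whose incoming labels are `M`, such that the incoming
labels of every other node form an element of `𝓜`. -/
def HasRootedTree (inv : Λ → Λ) (S : Set Λ) (𝓜 : Set (Multiset Λ)) (M : Multiset Λ) : Prop :=
  ∃ (X : LabelledTree inv S) (ρ : X.Node), X.incoming ρ = M ∧ ∀ t, t ≠ ρ → X.incoming t ∈ 𝓜

/-- There is a rooted labelled tree to be attached to other trees by an edge leaving its root with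
label `l`, so that all its nodes have their incoming labels in `𝓜`. -/
def HasBranch (inv : Λ → Λ) (S : Set Λ) (𝓜 : Set (Multiset Λ)) (l : Λ) : Prop :=
  l ∈ S ∧ ∃ M, HasRootedTree inv S 𝓜 M ∧ inv l ::ₘ M ∈ 𝓜

theorem hasRootedTree_zero [Nonempty Λ] (inv : Λ → Λ) (S : Set Λ) (𝓜 : Set (Multiset Λ)) :
    HasRootedTree inv S 𝓜 0 :=
  ⟨{ Node := Unit, T := ⊥, isTree := .of_subsingleton, α := fun _ _ => Classical.arbitrary Λ
     α_mem := fun _ _ h => h.elim, α_symm := fun _ _ h => h.elim },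
    (), by simp [LabelledTree.incoming], fun _ ht => absurd rfl ht⟩

theorem HasRootedTree.join (h : HasRootedTree inv S 𝓜 M) (h_inv : inv.Involutive)
    (hS : ∀ l ∈ S, inv l ∈ S) (hl : HasBranch inv S 𝓜 l) : HasRootedTree inv S 𝓜 (l ::ₘ M) := by
  classical
  obtain ⟨X, a, rfl, hX⟩ := h
  obtain ⟨hlS, _, ⟨Y, b, rfl, hY⟩, hl⟩ := hl
  refine ⟨X.join Y a b hlS (hS l hlS) (h_inv l), .inl a, ?_, ?_⟩
  · rw [LabelledTree.incoming_join_inl, if_pos rfl, add_comm, Multiset.singleton_add]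
  · rintro (t | t) ht
    · have hta : t ≠ a := fun h => ht (congrArg _ h)
      rw [LabelledTree.incoming_join_inl, if_neg hta, add_zero]
      exact hX t hta
    · rw [LabelledTree.incoming_join_inr]
      split_ifs with htb
      · rwa [htb, Multiset.singleton_add]
      · rw [zero_add]
        exact hY t htb

namespace HasBranch

theorem of_singleton_mem (hl : l ∈ S) (h : {inv l} ∈ 𝓜) : HasBranch inv S 𝓜 l :=
  have : Nonempty Λ := ⟨l⟩
  ⟨hl, 0, hasRootedTree_zero inv S 𝓜, h⟩

theorem of_triple_mem (h_inv : inv.Involutive) (hS : ∀ l ∈ S, inv l ∈ S) {x y z : Λ} (hx : x ∈ S)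
    (hy : HasBranch inv S 𝓜 y) (hz : HasBranch inv S 𝓜 z) (h : {inv x, y, z} ∈ 𝓜) :
    HasBranch inv S 𝓜 x :=
  have : Nonempty Λ := ⟨x⟩
  ⟨hx, _, ((hasRootedTree_zero inv S 𝓜).join h_inv hS hz).join h_inv hS hy, h⟩

theorem exists_labelledTree (h_inv : inv.Involutive) (hS : ∀ l ∈ S, inv l ∈ S)
    (h : HasBranch inv S 𝓜 l) (h' : HasBranch inv S 𝓜 (inv l)) :
    ∃ X : LabelledTree inv S, ∀ t, X.incoming t ∈ 𝓜 := by
  obtain ⟨-, M, hM, hlM⟩ := h'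
  rw [h_inv l] at hlM
  obtain ⟨X, ρ, hρ, hX⟩ := hM.join h_inv hS h
  refine ⟨X, fun t => ?_⟩
  obtain rfl | ht := eq_or_ne t ρ
  · rwa [hρ]
  · exact hX t ht

end HasBranch

end Branches

end LabelledTrees

section STrees

variable {V : Type*} {G : SimpleGraph V} {k : ℕ} {r : VSep G}

theorem singleton_top_mem_tangleFStar (hk : 0 < k) : {(⊤ : VSep G)} ∈ tangleFStar G k := by
  have h_top : (⊤ : VSep G) ∈ sepsBelow G k :=
    VSep.flip_mem_sepsBelow.2 (VSep.bot_mem_sepsBelow hk)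
  refine ⟨?_, Set.singleton_nonempty _, ?_⟩
  · simpa using mem_tangleF h_top h_top h_top fun W _ => .inl (Set.subset_univ W)
  · rintro _ rfl _ rfl h
    exact absurd rfl h

theorem Forces.hasBranch (h : Forces k {⊥} r) (hk : 0 < k) :
    HasBranch VSep.flip (sepsBelow G k) {M | {s | s ∈ M} ∈ tangleFStar G k} r := by
  induction h with
  | of_mem h =>
    obtain rfl := h
    refine .of_singleton_mem (VSep.bot_mem_sepsBelow hk) ?_
    simpa using singleton_top_mem_tangleFStar hk
  | @of_star x y z h _ _ ihy ihz =>
    refine .of_triple_mem (fun _ => rfl) (fun _ => VSep.flip_mem_sepsBelow.2)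
      (VSep.flip_mem_sepsBelow.2 h.mem₁) ihy ihz ?_
    change {s | s ∈ ({x, y, z} : Multiset (VSep G))} ∈ tangleFStar G k
    convert h.mem_tangleFStar using 1
    ext s
    simp

theorem Forces.exists_isOver (h : Forces k {⊥} (⊤ : VSep G)) (hk : 0 < k) :
    ∃ X : STree (sepsBelow G k), X.IsOver (tangleFStar G k) := by
  have h_bot : Forces k {⊥} (⊥ : VSep G) := .of_mem rfl
  obtain ⟨X, hX⟩ := (h_bot.hasBranch hk).exists_labelledTree (fun _ => rfl)
    (fun _ => VSep.flip_mem_sepsBelow.2) (h.hasBranch hk)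
  have h_dart : Nonempty X.T.Dart := by
    obtain ⟨t⟩ := X.isTree.connected.nonempty
    obtain ⟨s, hs⟩ := (hX t).2.1
    obtain ⟨x, hx, -⟩ := X.mem_incoming.1 hs
    exact ⟨⟨(x, t), hx⟩⟩
  exact ⟨X.toSTree h_dart, fun t => Set.mem_of_eq_of_mem (X.starAt_toSTree h_dart t) (hX t)⟩

end STrees

section BranchingTrees

open Classical in
/-- The possible incoming labels at the nodes of a tree that branches a set `E`, where each edge is
labelled by the set of those elements whose leaves lie behind it: at the leaf of `f` the only label
is `{f}ᶜ`, and at the other nodes three labels partition `E`. -/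
def branchNodes (E : Type*) : Set (Multiset (Set E)) :=
  {M | (∃ f, M = {{f}ᶜ}) ∨ (M.card = 3 ∧ ∀ f : E, M.countP (f ∈ ·) = 1)}

/-- The sets that can be built up from singletons by disjoint unions within `S`. -/
inductive Built {E : Type*} (S : Set (Set E)) : Set E → Prop
  | empty : Built S ∅
  | singleton {f : E} : {f} ∈ S → Built S {f}
  | union {X Y : Set E} : Built S X → Built S Y → Disjoint X Y → X ∪ Y ∈ S → Built S (X ∪ Y)

variable {E : Type*} {S : Set (Set E)} {A X Y : Set E} {f : E}

namespace Built

theorem insert_of_mem (h : Built S X) (hf : {f} ∈ S) (hX : insert f X ∈ S) :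
    Built S (insert f X) := by
  by_cases hfX : f ∈ X
  · rwa [Set.insert_eq_of_mem hfX]
  · rw [Set.insert_eq] at hX ⊢
    exact .union (.singleton hf) h (Set.disjoint_singleton_left.2 hfX) hX

theorem extend [Finite E] (hA : Built S A) (hAX : A ⊆ X) (h_single : ∀ f ∈ X, {f} ∈ S)
    (h_mem : ∀ Y, A ⊆ Y → Y ⊆ X → Y ∈ S) : Built S X := by
  suffices h : ∀ D ⊆ X, Built S (D ∪ A) by
    simpa only [Set.union_eq_self_of_subset_right hAX] using h X subset_rfl
  intro D hD
  induction D, Set.toFinite D using Set.Finite.induction_on with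
  | empty => rwa [Set.empty_union]
  | @insert f D _ _ ih =>
    obtain ⟨hf, hD⟩ := Set.insert_subset_iff.1 hD
    rw [Set.insert_union]
    exact (ih hD).insert_of_mem (h_single f hf) (h_mem _
      (Set.subset_union_right.trans (Set.subset_insert _ _))
      (Set.insert_subset hf (Set.union_subset hD hAX)))

theorem hasBranch (h : Built S X) (hS : ∀ X ∈ S, Xᶜ ∈ S) (hX : X.Nonempty) :
    HasBranch compl S (branchNodes E) X := by
  induction h with
  | empty => exact absurd hX Set.not_nonempty_empty
  | singleton hf => exact .of_singleton_mem hf (.inl ⟨_, rfl⟩)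
  | @union X Y _ _ h_disj h_mem ihX ihY =>
    obtain rfl | hX' := X.eq_empty_or_nonempty
    · rw [Set.empty_union] at hX ⊢
      exact ihY hX
    obtain rfl | hY' := Y.eq_empty_or_nonempty
    · rw [Set.union_empty] at hX ⊢
      exact ihX hX
    refine .of_triple_mem compl_compl hS h_mem (ihX hX') (ihY hY') (.inr ⟨rfl, fun f => ?_⟩)
    have h_notMem : f ∈ X → f ∉ Y := fun h => Set.disjoint_left.1 h_disj h
    simp only [Multiset.insert_eq_cons, ← Multiset.cons_zero, Multiset.countP_cons,
      Multiset.countP_zero]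
    by_cases hfX : f ∈ X <;> by_cases hfY : f ∈ Y <;> simp_all

theorem exists_hasBranch_compl [Nontrivial E] (h : Built S Set.univ) (hS : ∀ X ∈ S, Xᶜ ∈ S) :
    ∃ X, HasBranch compl S (branchNodes E) X ∧ HasBranch compl S (branchNodes E) Xᶜ := by
  generalize h_univ : Set.univ = U at h
  induction h with
  | empty => exact absurd h_univ Set.univ_nonempty.ne_empty
  | @singleton f =>
    obtain ⟨g, hg⟩ := exists_ne f
    exact absurd (h_univ ▸ Set.mem_univ g : g ∈ ({f} : Set E)) hg
  | @union X Y hX hY h_disj _ ihX ihY =>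
    obtain rfl | hX' := X.eq_empty_or_nonempty
    · exact ihY (by rw [h_univ, Set.empty_union])
    obtain rfl | hY' := Y.eq_empty_or_nonempty
    · exact ihX (by rw [h_univ, Set.union_empty])
    have h_compl : Xᶜ = Y := (IsCompl.of_eq (disjoint_iff.1 h_disj) h_univ.symm).compl_eq
    exact ⟨X, hX.hasBranch hS hX', h_compl ▸ hY.hasBranch hS hY'⟩

theorem exists_labelledTree [Nontrivial E] (h : Built S Set.univ) (hS : ∀ X ∈ S, Xᶜ ∈ S) :
    ∃ X : LabelledTree (compl : Set E → Set E) S, ∀ t, X.incoming t ∈ branchNodes E :=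
  have ⟨_, hX, hX'⟩ := h.exists_hasBranch_compl hS
  hX.exists_labelledTree compl_compl hS hX'

end Built

namespace LabelledTree

variable {X : LabelledTree (compl : Set E → Set E) S} {x y s t : X.Node}

theorem mem_or_mem (hxy : X.T.Adj x y) (f : E) : f ∈ X.α x y ∨ f ∈ X.α y x := by
  rw [X.α_symm x y hxy]
  exact em _

theorem notMem_of_incoming_eq (ht : X.incoming t = {{f}ᶜ}) (hx : X.T.Adj x t) :
    f ∉ X.α x t := by
  have h : X.α x t ∈ X.incoming t := X.mem_incoming.2 ⟨x, hx, rfl⟩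
  rw [ht, Multiset.mem_singleton] at h
  exact fun hf => (h ▸ hf) rfl

variable (hX : ∀ t, X.incoming t ∈ branchNodes E)

include hX

theorem existsUnique_adj_mem (ht : X.incoming t ≠ {{f}ᶜ}) :
    ∃! x, X.T.Adj x t ∧ f ∈ X.α x t := by
  classical
  have h_count : (X.incoming t).countP (f ∈ ·) = 1 := by
    rcases hX t with ⟨g, hg⟩ | ⟨-, h⟩
    · have hgf : f ≠ g := fun h => ht (h ▸ hg)
      rw [hg, ← Multiset.cons_zero, Multiset.countP_cons_of_pos (p := (f ∈ ·)) _ hgf,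
        Multiset.countP_zero]
    · exact h f
  rw [incoming, Multiset.countP_map, ← Finset.filter_val, Finset.card_val,
    Finset.card_eq_one] at h_count
  obtain ⟨x, hx⟩ := h_count
  simp only [Finset.ext_iff, Finset.mem_filter, Set.Finite.mem_toFinset,
    SimpleGraph.mem_neighborSet, Finset.mem_singleton, X.T.adj_comm t] at hx
  exact ⟨x, (hx x).2 rfl, fun y hy => (hx y).1 hy⟩

theorem mem_of_isPath (p : X.T.Walk x t) (hp : p.IsPath) (ht : X.incoming t = {{f}ᶜ})
    (hxy : X.T.Adj x y) (hy : y ∉ p.support) : f ∈ X.α x y := by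
  induction p generalizing y with
  | nil => exact (X.mem_or_mem hxy f).resolve_right (notMem_of_incoming_eq ht hxy.symm)
  | @cons x x' t hxx' p ih =>
    rw [SimpleGraph.Walk.cons_isPath_iff] at hp
    rw [SimpleGraph.Walk.support_cons, List.mem_cons, not_or] at hy
    have hx' : f ∈ X.α x' x := ih hp.1 ht hxx'.symm hp.2
    have hx_leaf : X.incoming x ≠ {{f}ᶜ} := fun hx => notMem_of_incoming_eq hx hxx'.symm hx'
    refine (X.mem_or_mem hxy f).resolve_right fun hyx => hy.2 ?_
    rw [(existsUnique_adj_mem hX hx_leaf).unique ⟨hxy.symm, hyx⟩ ⟨hxx'.symm, hx'⟩]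
    exact p.start_mem_support

theorem eq_of_incoming_eq (hs : X.incoming s = {{f}ᶜ}) (ht : X.incoming t = {{f}ᶜ}) :
    s = t := by
  obtain ⟨p, hp⟩ := (X.isTree.connected.preconnected s t).exists_isPath
  cases p with
  | nil => rfl
  | cons hsx p =>
    rw [SimpleGraph.Walk.cons_isPath_iff] at hp
    exact absurd (mem_of_isPath hX p hp.1 ht hsx.symm hp.2) (notMem_of_incoming_eq hs hsx.symm)

theorem exists_incoming_eq (f : E) : ∃ t, X.incoming t = {{f}ᶜ} := by
  obtain ⟨t, ht⟩ := exists_forall_adj_of_isTree X.isTree (P := fun x y => f ∉ X.α x y)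
    fun x y hxy => by
      rw [X.α_symm x y hxy]
      exact (em' _).imp_right fun h h' => h' h
  by_contra! h
  obtain ⟨x, ⟨hx, hf⟩, -⟩ := existsUnique_adj_mem hX (h t)
  exact ht x hx hf

theorem ncard_neighborSet (t : X.Node) :
    (∃ f, X.incoming t = {{f}ᶜ}) ∧ (X.T.neighborSet t).ncard = 1 ∨
      (X.T.neighborSet t).ncard = 3 := by
  rw [← X.card_incoming]
  exact (hX t).imp (fun ⟨f, hf⟩ => ⟨⟨f, hf⟩, hf ▸ Multiset.card_singleton _⟩) And.left

theorem exists_leafEquiv :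
    ∃ L : E ≃ {t : X.Node // (X.T.neighborSet t).ncard = 1}, ∀ f, X.incoming (L f) = {{f}ᶜ} := by
  choose L hL using exists_incoming_eq hX
  have hL_leaf : ∀ f, (X.T.neighborSet (L f)).ncard = 1 := fun f => by
    rw [← X.card_incoming, hL, Multiset.card_singleton]
  refine ⟨.ofBijective (fun f => ⟨L f, hL_leaf f⟩) ⟨fun f g hfg => ?_, ?_⟩, hL⟩
  · have h := hL f
    rw [show (L f : X.Node) = L g from congrArg Subtype.val hfg, hL g] at h
    simpa using h.symm
  · rintro ⟨t, ht⟩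
    rcases ncard_neighborSet hX t with ⟨⟨f, hf⟩, -⟩ | h
    · exact ⟨f, Subtype.ext (eq_of_incoming_eq hX (hL f) hf)⟩
    · omega

end LabelledTree

end BranchingTrees

section EdgeSets

variable {V : Type*} {G : SimpleGraph V} {k : ℕ} {X Y : Set G.edgeSet} {r s : VSep G}

/-- The vertices incident both with an edge in `X` and with an edge not in `X`. -/
def boundary (X : Set G.edgeSet) : Set V :=
  {v | (∃ f ∈ X, v ∈ f.1) ∧ ∃ f ∈ Xᶜ, v ∈ f.1}

variable (G) in
/-- The sets of edges with fewer than `k` boundary vertices. -/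
def edgeSetsBelow (k : ℕ) : Set (Set G.edgeSet) :=
  {X | (boundary X).ncard < k}

/-- The edges of `G[W]`. -/
def inducedEdges (W : Set V) : Set G.edgeSet :=
  {f | (f.1 : Set V) ⊆ W}

theorem boundary_compl (X : Set G.edgeSet) : boundary Xᶜ = boundary X := by
  ext v
  simp only [boundary, compl_compl]
  exact and_comm

theorem compl_mem_edgeSetsBelow (h : X ∈ edgeSetsBelow G k) : Xᶜ ∈ edgeSetsBelow G k := by
  rwa [edgeSetsBelow, Set.mem_ofPred_eq, boundary_compl]

theorem ncard_edge_le (f : G.edgeSet) : (f.1 : Set V).ncard ≤ 2 := by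
  obtain ⟨u, v, -, h⟩ := isCell_of_mem_edgeSet f.2
  rw [h]
  exact (Set.ncard_insert_le u {v}).trans_eq (by rw [Set.ncard_singleton])

theorem singleton_mem_edgeSetsBelow [Finite V] (hk : 3 ≤ k) (f : G.edgeSet) :
    {f} ∈ edgeSetsBelow G k := by
  refine ((Set.ncard_le_ncard ?_).trans (ncard_edge_le f)).trans_lt hk
  rintro v ⟨⟨_, rfl, hv⟩, -⟩
  exact hv

theorem inducedEdges_empty : inducedEdges (G := G) ∅ = ∅ := by
  refine Set.eq_empty_of_forall_notMem fun f hf => ?_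
  obtain ⟨u, v, -, h⟩ := isCell_of_mem_edgeSet f.2
  exact hf (h.ge (Set.mem_insert u {v}))

/-- `s` separates `X` from its complement: the edges in `X` lie in the first side of `s` and the
other edges lie in its second side. -/
def VSep.Separates (s : VSep G) (X : Set G.edgeSet) : Prop :=
  X ⊆ inducedEdges s.A ∧ Xᶜ ⊆ inducedEdges s.B

namespace VSep.Separates

theorem mem_edgeSetsBelow [Finite V] (h : s.Separates X) (hs : s ∈ sepsBelow G k) :
    X ∈ edgeSetsBelow G k := by
  refine (Set.ncard_le_ncard ?_).trans_lt hs
  rintro v ⟨⟨f, hf, hv⟩, ⟨g, hg, hv'⟩⟩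
  exact ⟨h.1 hf hv, h.2 hg hv'⟩

theorem inter (h : r.Separates X) (hsr : s ≤ r) : s.Separates (X ∩ inducedEdges s.A) := by
  refine ⟨Set.inter_subset_right, fun f hf => ?_⟩
  by_cases hfX : f ∈ X
  · exact (s.subset_or (isCell_of_mem_edgeSet f.2)).resolve_left fun h => hf ⟨hfX, h⟩
  · exact (h.2 hfX).trans hsr.2

theorem diff (h : s.Separates X) (hY : Y ⊆ inducedEdges s.B) : s.Separates (X \ Y) := by
  refine ⟨Set.sdiff_subset.trans h.1, fun f hf => ?_⟩
  by_cases hfX : f ∈ X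
  · exact hY (by_contra fun hfY => hf ⟨hfX, hfY⟩)
  · exact h.2 hfX

end VSep.Separates

theorem Forces.built [Finite V] (h : Forces k {⊥} r) (hk : 3 ≤ k) (hX : r.Separates X) :
    Built (edgeSetsBelow G k) X := by
  induction h generalizing X with
  | of_mem h =>
    obtain rfl := h
    rw [Set.subset_empty_iff.1 (hX.1.trans_eq inducedEdges_empty)]
    exact .empty
  | @of_star x y z h _ _ ihy ihz =>
    let Y := X ∩ inducedEdges y.A
    let Z := (X ∩ inducedEdges z.A) \ Y
    have hY : y.Separates Y := hX.inter h.rotate.le₁₃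
    have hZ : z.Separates Z := (hX.inter h.rotate.rotate.le₁₂).diff fun f hf => hf.2.trans h.le₂₃.1
    have hYZ : Y ∪ Z ⊆ X :=
      Set.union_subset Set.inter_subset_left (Set.sdiff_subset.trans Set.inter_subset_left)
    have h_rest : (Y ∪ Z)ᶜ ⊆ inducedEdges x.A := by
      intro f hf
      by_cases hfX : f ∈ X
      · refine (h.covers _ (isCell_of_mem_edgeSet f.2)).resolve_right ?_
        rintro (hfy | hfz)
        · exact hf (.inl ⟨hfX, hfy⟩)
        · exact hf (Set.union_sdiff_self.ge (.inr ⟨hfX, hfz⟩))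
      · exact hX.2 hfX
    have h_mem : ∀ W, Y ∪ Z ⊆ W → W ⊆ X → W ∈ edgeSetsBelow G k := fun W hW hWX =>
      VSep.Separates.mem_edgeSetsBelow (s := x.flip)
        ⟨hWX.trans hX.1, (Set.compl_subset_compl.2 hW).trans h_rest⟩
        (VSep.flip_mem_sepsBelow.2 h.mem₁)
    exact (Built.union (ihy hY) (ihz hZ) Set.disjoint_sdiff_right (h_mem _ subset_rfl hYZ)).extend
      hYZ (fun f _ => singleton_mem_edgeSetsBelow hk f) h_mem

end EdgeSets

section BranchWidth

variable {V : Type*} {G : SimpleGraph V} {k : ℕ}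

theorem BranchDecomposition.edgeOrder_le_width (X : BranchDecomposition G) (e : X.T.Dart) :
    X.edgeOrder e ≤ X.width := by
  have := X.finite_node
  have : Finite X.T.Dart := Finite.of_injective _ SimpleGraph.Dart.toProd_injective
  exact le_ciSup (Set.finite_range _).bddAbove e

theorem BranchDecomposition.width_lt {X : BranchDecomposition G} (hk : 0 < k)
    (h : ∀ e, X.edgeOrder e < k) : X.width < k :=
  (ciSup_le' fun e => Nat.le_sub_one_of_lt (h e)).trans_lt (Nat.sub_one_lt_of_lt hk)

theorem LabelledTree.exists_branchDecomposition [Finite V]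
    {X : LabelledTree (compl : Set G.edgeSet → Set G.edgeSet) (edgeSetsBelow G k)}
    (hX : ∀ t, X.incoming t ∈ branchNodes G.edgeSet) (hk : 0 < k) :
    ∃ Y : BranchDecomposition G, Y.width < k := by
  obtain ⟨L, hL⟩ := exists_leafEquiv hX
  let Y : BranchDecomposition G :=
    { Node := X.Node
      finite_node := inferInstance
      T := X.T
      isTree := X.isTree
      ternary := fun t => (ncard_neighborSet hX t).imp_left And.right
      L := L }
  classical
  have mem_of_mem_side : ∀ (e : X.T.Dart) (f : G.edgeSet), (L f).1 ∈ Y.side e →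
      f ∈ X.α e.fst e.snd := by
    rintro ⟨⟨x, y⟩, hxy⟩ f hf
    obtain ⟨p, hp⟩ := SimpleGraph.Reachable.exists_isPath hf
    refine mem_of_isPath hX (p.mapLe (SimpleGraph.deleteEdges_le _)) (hp.mapLe _) (hL f) hxy
      fun hy => ?_
    rw [SimpleGraph.Walk.support_mapLe_eq_support] at hy
    exact SimpleGraph.isAcyclic_iff_forall_adj_isBridge.1 X.isTree.isAcyclic hxy
      (p.takeUntil y hy).reachable
  refine ⟨Y, BranchDecomposition.width_lt hk fun e => ?_⟩
  refine (Set.ncard_le_ncard ?_).trans_lt (X.α_mem _ _ e.adj)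
  rintro v ⟨⟨f, hv, hf⟩, ⟨g, hv', hg⟩⟩
  refine ⟨⟨f, mem_of_mem_side e f hf, hv⟩, g, ?_, hv'⟩
  rw [← X.α_symm _ _ e.adj]
  exact mem_of_mem_side e.symm g hg

theorem Built.exists_branchDecomposition [Finite V] (h : Built (edgeSetsBelow G k) Set.univ)
    (hk : 0 < k) (hE : 1 < G.edgeSet.ncard) : ∃ X : BranchDecomposition G, X.width < k := by
  have : Nontrivial G.edgeSet := (Set.one_lt_ncard_iff_nontrivial.1 hE).coe_sort
  obtain ⟨X, hX⟩ := h.exists_labelledTree fun _ => compl_mem_edgeSetsBelow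
  exact LabelledTree.exists_branchDecomposition hX hk

theorem nonempty_branchDecomposition [Finite V] (hE : 1 < G.edgeSet.ncard) :
    Nonempty (BranchDecomposition G) := by
  have h_mem : ∀ Y, Y ∈ edgeSetsBelow G (Nat.card V + 1) := fun Y =>
    Nat.lt_succ_of_le (Set.ncard_le_card (boundary Y))
  have h_built : Built (edgeSetsBelow G (Nat.card V + 1)) Set.univ :=
    Built.empty.extend (Set.empty_subset _) (fun f _ => h_mem {f}) fun Y _ _ => h_mem Y
  exact (h_built.exists_branchDecomposition (Nat.succ_pos _) hE).nonempty

theorem branchWidth_le_width (X : BranchDecomposition G) : branchWidth G ≤ X.width := by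
  rw [branchWidth]
  split_ifs
  · exact Nat.zero_le _
  · exact Nat.sInf_le (Set.mem_range_self X)

theorem branchWidth_eq_zero (hE : G.edgeSet.ncard ≤ 1) : branchWidth G = 0 :=
  if_pos hE

theorem le_branchWidth [Finite V] (hE : 1 < G.edgeSet.ncard)
    (h : ∀ X : BranchDecomposition G, k ≤ X.width) : k ≤ branchWidth G := by
  have := nonempty_branchDecomposition hE
  rw [branchWidth, if_neg hE.not_ge]
  exact le_csInf (Set.range_nonempty _) (Set.forall_mem_range.2 h)

theorem Forces.branchWidth_lt [Finite V] (h : Forces k {⊥} (⊤ : VSep G)) (hk : 3 ≤ k) :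
    branchWidth G < k := by
  obtain hE | hE := le_or_gt G.edgeSet.ncard 1
  · rw [branchWidth_eq_zero hE]
    omega
  · have h_univ : (⊤ : VSep G).Separates Set.univ :=
      ⟨fun f _ => Set.subset_univ _, fun f hf => absurd trivial hf⟩
    obtain ⟨X, hX⟩ := (h.built hk h_univ).exists_branchDecomposition (by omega) hE
    exact (branchWidth_le_width X).trans_lt hX

end BranchWidth

section TangleEdges

variable {V : Type*} {G : SimpleGraph V} {k : ℕ} {O : Set (VSep G)} {r s t : VSep G} {v : V}

theorem IsCell.subset_edge_or_subset_compl_support {W : Set V} (hW : IsCell G W) :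
    (∃ f : G.edgeSet, W ⊆ f.1) ∨ W ⊆ G.supportᶜ := by
  obtain ⟨u, v, rfl | huv, rfl⟩ := hW
  · rw [Set.pair_eq_singleton, Set.singleton_subset_iff]
    by_cases hu : u ∈ G.support
    · obtain ⟨w, huw⟩ := hu
      exact .inl ⟨⟨s(u, w), huw⟩, Set.singleton_subset_iff.2 (Sym2.mem_mk_left u w)⟩
    · exact .inr hu
  · exact .inl ⟨⟨s(u, v), huv⟩, Sym2.coe_mk.ge⟩

namespace VSep

/-- The separation `(W, V)`. -/
def small (G : SimpleGraph V) (W : Set V) : VSep G :=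
  ofCells W Set.univ fun _ _ => .inr (Set.subset_univ _)

@[simp] theorem order_small (W : Set V) : (small G W).order = W.ncard :=
  congrArg Set.ncard (Set.inter_univ W)

/-- The separation `({v}, V \ {v})` for an isolated vertex `v`. -/
def isolated (v : V) (hv : v ∉ G.support) : VSep G :=
  ofCells {v} {v}ᶜ fun W hW => by
    by_cases hvW : v ∈ W
    · exact .inl fun w hw => (hW.eq_or_adj hw hvW).resolve_right fun h => hv h.mem_support_right
    · exact .inr (Set.subset_compl_singleton_iff.2 hvW)

@[simp] theorem order_isolated (hv : v ∉ G.support) : (isolated v hv).order = 0 := by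
  simp [order, isolated]

end VSep

namespace IsTangle

theorem small_mem (hO : IsTangle G k O) {W : Set V} (hW : W.ncard < k) : VSep.small G W ∈ O := by
  have h_mem : VSep.small G W ∈ sepsBelow G k := (VSep.order_small W).trans_lt hW
  refine (hO.mem_or h_mem).resolve_right fun h => ?_
  exact hO.not_covers h h h fun _ _ => .inl (Set.subset_univ _)

theorem sup_isolated_mem [Finite V] (hO : IsTangle G k O) (hk : 2 ≤ k) (hs : s ∈ O)
    (hv : v ∉ G.support) : s ⊔ VSep.isolated v hv ∈ O := by
  have h_mem : s ⊔ VSep.isolated v hv ∈ sepsBelow G k := by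
    have h_le := VSep.order_inf_add_order_sup_le s (VSep.isolated v hv)
    rw [VSep.order_isolated] at h_le
    exact (le_of_add_le_right h_le).trans_lt (hO.subset hs)
  have h_small : VSep.small G {v} ∈ O := hO.small_mem (by rw [Set.ncard_singleton]; omega)
  refine (hO.mem_or h_mem).resolve_right fun h => hO.not_covers h hs h_small fun W hW => ?_
  rcases (VSep.isolated v hv).subset_or hW with h | h
  · exact .inr (.inr h)
  · exact (s.subset_or hW).elim (.inr ∘ .inl) fun h' => .inl (Set.subset_inter h' h)

theorem exists_ge_compl_support_subset [Finite V] (hO : IsTangle G k O) (hk : 2 ≤ k)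
    (hs : s ∈ O) : ∃ r ∈ O, s ≤ r ∧ G.supportᶜ ⊆ r.A := by
  obtain ⟨r, hsr, hr⟩ := (Set.toFinite O).exists_le_maximal hs
  refine ⟨r, hr.prop, hsr, fun v hv => ?_⟩
  exact (hr.le_of_ge (hO.sup_isolated_mem hk hr.prop hv) le_sup_left).1 (.inr rfl)

theorem not_covers_edges [Finite V] (hO : IsTangle G k O) (hk : 2 ≤ k) (hr : r ∈ O) (hs : s ∈ O)
    (ht : t ∈ O) :
    ¬ ∀ f : G.edgeSet, f ∈ inducedEdges r.A ∨ f ∈ inducedEdges s.A ∨ f ∈ inducedEdges t.A := by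
  intro h
  obtain ⟨r', hr', hrr', h_iso⟩ := hO.exists_ge_compl_support_subset hk hr
  refine hO.not_covers hr' hs ht fun W hW => ?_
  rcases hW.subset_edge_or_subset_compl_support with ⟨f, hf⟩ | hW
  · exact (h f).imp (fun h => (hf.trans h).trans hrr'.1) (.imp hf.trans hf.trans)
  · exact .inl (hW.trans h_iso)

theorem exists_notMem_inducedEdges [Finite V] (hO : IsTangle G k O) (hk : 2 ≤ k) (hs : s ∈ O) :
    ∃ f : G.edgeSet, f ∉ inducedEdges s.A := by
  by_contra! h
  exact hO.not_covers_edges hk hs hs hs fun f => .inl (h f)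

theorem edgeSet_nonempty [Finite V] (hO : IsTangle G k O) (hk : 2 ≤ k) : G.edgeSet.Nonempty :=
  have ⟨f, _⟩ := hO.exists_notMem_inducedEdges hk
    (hO.small_mem (W := ∅) (by rw [Set.ncard_empty]; omega))
  ⟨f, f.2⟩

theorem small_edge_mem (hO : IsTangle G k O) (hk : 3 ≤ k) (f : G.edgeSet) :
    VSep.small G f.1 ∈ O :=
  hO.small_mem ((ncard_edge_le f).trans_lt hk)

theorem one_lt_ncard_edgeSet [Finite V] (hO : IsTangle G k O) (hk : 3 ≤ k) :
    1 < G.edgeSet.ncard := by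
  obtain ⟨f, hf⟩ := hO.edgeSet_nonempty (by omega)
  obtain ⟨g, hg⟩ :=
    hO.exists_notMem_inducedEdges (by omega) (hO.small_edge_mem hk ⟨f, hf⟩)
  refine (Set.one_lt_ncard (Set.toFinite _)).2 ⟨f, hf, g, g.2, ?_⟩
  rintro rfl
  exact hg (subset_refl (g.1 : Set V))

end IsTangle

end TangleEdges

namespace BranchDecomposition

variable {V : Type*} {G : SimpleGraph V} {X : BranchDecomposition G} {t l : X.Node} {f : G.edgeSet}

theorem exists_mem_side (h : l ≠ t) : ∃ u, ∃ hu : X.T.Adj u t, l ∈ X.side ⟨(u, t), hu⟩ := by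
  obtain ⟨p, hp⟩ := (X.isTree.connected.preconnected t l).exists_isPath
  cases p with
  | nil => exact absurd rfl h
  | @cons _ u _ htu p =>
    rw [SimpleGraph.Walk.cons_isPath_iff] at hp
    refine ⟨u, htu.symm, ⟨p.toDeleteEdges _ ?_⟩⟩
    rintro _ he rfl
    exact hp.2 (p.snd_mem_support_of_mem_edges he)

theorem mem_side_or (e : X.T.Dart) (l : X.Node) : l ∈ X.side e ∨ l ∈ X.side e.symm := by
  obtain ⟨⟨a, b⟩, hab⟩ := e
  obtain ⟨p⟩ := X.isTree.connected.preconnected l a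
  simp only [side, Set.mem_ofPred_eq, SimpleGraph.Dart.edge_symm]
  change (X.T.deleteEdges {s(a, b)}).Reachable a l ∨ (X.T.deleteEdges {s(a, b)}).Reachable b l
  induction p with
  | nil => exact .inl .rfl
  | @cons x y a hxy p ih =>
    by_cases h_edge : s(x, y) = s(a, b)
    · obtain ⟨rfl, -⟩ | ⟨rfl, -⟩ := Sym2.eq_iff.1 h_edge
      exacts [.inl .rfl, .inr .rfl]
    · have h_adj : (X.T.deleteEdges {s(a, b)}).Adj y x :=
        (SimpleGraph.deleteEdges_adj.2 ⟨hxy, h_edge⟩).symm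
      exact (ih hab).imp (·.trans h_adj.reachable) (·.trans h_adj.reachable)

theorem mem_inducedEdges_sideVerts {e : X.T.Dart} (h : (X.L f).1 ∈ X.side e) :
    f ∈ inducedEdges (X.sideVerts e) :=
  fun _ hv => ⟨f, hv, h⟩

theorem exists_mem_inducedEdges_sideVerts (h : (X.L f).1 ≠ t) :
    ∃ u, ∃ hu : X.T.Adj u t, f ∈ inducedEdges (X.sideVerts ⟨(u, t), hu⟩) :=
  have ⟨u, hu, hf⟩ := exists_mem_side h
  ⟨u, hu, mem_inducedEdges_sideVerts hf⟩

theorem exists_dart_leaf (X : BranchDecomposition G) (f : G.edgeSet) :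
    ∃ e : X.T.Dart, e.snd = X.L f ∧ f ∈ inducedEdges (X.sideVerts e.symm) ∧
      ∀ g ≠ f, g ∈ inducedEdges (X.sideVerts e) := by
  obtain ⟨u, hu⟩ := Set.ncard_eq_one.1 (X.L f).2
  have h_adj : X.T.Adj u (X.L f) := SimpleGraph.Adj.symm (hu.ge rfl : u ∈ X.T.neighborSet _)
  refine ⟨⟨(u, X.L f), h_adj⟩, rfl, mem_inducedEdges_sideVerts .rfl, fun g hg => ?_⟩
  obtain ⟨w, hw, hgw⟩ := exists_mem_inducedEdges_sideVerts (X := X)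
    fun h => hg (X.L.injective (Subtype.ext h))
  obtain rfl : w = u := hu.le hw.symm
  exact hgw

/-- The separation of `G` displayed by an edge of a branch-decomposition. Isolated vertices are put
on its second side, so that they do not contribute to its order. -/
def sep (X : BranchDecomposition G) (e : X.T.Dart) : VSep G :=
  VSep.ofCells (X.sideVerts e) (X.sideVerts e.symm ∪ G.supportᶜ) fun W hW => by
    rcases hW.subset_edge_or_subset_compl_support with ⟨f, hf⟩ | hW
    · exact (mem_side_or e (X.L f)).imp (fun h => hf.trans (mem_inducedEdges_sideVerts h))
        fun h => (hf.trans (mem_inducedEdges_sideVerts h)).trans Set.subset_union_left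
    · exact .inr (hW.trans Set.subset_union_right)

theorem sideVerts_subset_support (e : X.T.Dart) : X.sideVerts e ⊆ G.support := by
  rintro v ⟨⟨f, hf⟩, ⟨w, rfl⟩, -⟩
  exact ⟨w, hf⟩

theorem order_sep_le [Finite V] (X : BranchDecomposition G) (e : X.T.Dart) :
    (X.sep e).order ≤ X.width := by
  refine (Set.ncard_le_ncard ?_).trans (X.edgeOrder_le_width e)
  rintro v ⟨hv, hv' | hv'⟩
  · exact ⟨hv, hv'⟩
  · exact absurd (sideVerts_subset_support e hv) hv'

end BranchDecomposition

section TangleToBranchWidth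

variable {V : Type*} [Finite V] {G : SimpleGraph V} {k : ℕ} {O : Set (VSep G)}
  {X : BranchDecomposition G} {t : X.Node}

namespace IsTangle

theorem sep_mem_or (hO : IsTangle G k O) (hX : X.width < k) (e : X.T.Dart) :
    X.sep e ∈ O ∨ X.sep e.symm ∈ O :=
  (hO.mem_or ((X.order_sep_le e).trans_lt hX)).imp_right fun h =>
    hO.mem_of_le h ((X.order_sep_le e.symm).trans_lt hX)
      ⟨Set.subset_union_left, Set.subset_union_left⟩

theorem exists_forall_sep_mem (hO : IsTangle G k O) (hX : X.width < k) :
    ∃ t, ∀ x, ∀ hx : X.T.Adj x t, X.sep ⟨(x, t), hx⟩ ∈ O := by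
  have := X.finite_node
  obtain ⟨t, ht⟩ := exists_forall_adj_of_isTree X.isTree
    (P := fun x y => ∃ h : X.T.Adj x y, X.sep ⟨(x, y), h⟩ ∈ O) fun x y h =>
      (hO.sep_mem_or hX ⟨(x, y), h⟩).imp (⟨h, ·⟩) (⟨h.symm, ·⟩)
  exact ⟨t, fun x hx => (ht x hx).2⟩

theorem ncard_neighborSet_ne_one (hO : IsTangle G k O) (hk : 3 ≤ k)
    (ht : ∀ x, ∀ hx : X.T.Adj x t, X.sep ⟨(x, t), hx⟩ ∈ O) : (X.T.neighborSet t).ncard ≠ 1 := by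
  intro h_leaf
  obtain ⟨f, hf⟩ := X.L.surjective ⟨t, h_leaf⟩
  obtain ⟨⟨⟨x, _⟩, hx⟩, rfl, -, h⟩ := X.exists_dart_leaf f
  obtain rfl : (X.L f).1 = t := congrArg Subtype.val hf
  refine hO.not_covers_edges (by omega) (hO.small_edge_mem hk f) (ht x hx) (ht x hx) fun g => ?_
  obtain rfl | hg := eq_or_ne g f
  · exact .inl (subset_refl (g.1 : Set V))
  · exact .inr (.inl (h g hg))

theorem ncard_neighborSet_ne_three (hO : IsTangle G k O) (hk : 2 ≤ k)
    (ht : ∀ x, ∀ hx : X.T.Adj x t, X.sep ⟨(x, t), hx⟩ ∈ O) : (X.T.neighborSet t).ncard ≠ 3 := by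
  intro h_three
  obtain ⟨x, y, z, -, -, -, h_eq⟩ := Set.ncard_eq_three.1 h_three
  have h_adj : ∀ w ∈ ({x, y, z} : Set X.Node), X.T.Adj w t := fun w hw =>
    SimpleGraph.Adj.symm (h_eq ▸ hw : w ∈ X.T.neighborSet t)
  have h_mem : ∀ w, ∀ hw : w ∈ ({x, y, z} : Set X.Node), X.sep ⟨(w, t), h_adj w hw⟩ ∈ O :=
    fun w hw => ht w (h_adj w hw)
  refine hO.not_covers_edges hk (h_mem x (by simp)) (h_mem y (by simp)) (h_mem z (by simp))
    fun f => ?_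
  have hf : (X.L f).1 ≠ t := by
    rintro rfl
    have := (X.L f).2
    omega
  obtain ⟨w, hw, hfw⟩ := BranchDecomposition.exists_mem_inducedEdges_sideVerts hf
  obtain rfl | rfl | rfl : w ∈ ({x, y, z} : Set X.Node) := h_eq ▸ hw.symm
  exacts [.inl hfw, .inr (.inl hfw), .inr (.inr hfw)]

theorem le_width (hO : IsTangle G k O) (hk : 3 ≤ k) (X : BranchDecomposition G) :
    k ≤ X.width := by
  by_contra! hX
  obtain ⟨t, ht⟩ := hO.exists_forall_sep_mem hX
  exact (X.ternary t).elim (hO.ncard_neighborSet_ne_one hk ht)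
    (hO.ncard_neighborSet_ne_three (by omega) ht)

end IsTangle

theorem exists_isTangle_iff_le_branchWidth (hk : 3 ≤ k) :
    (∃ O, IsTangle G k O) ↔ k ≤ branchWidth G := by
  constructor
  · rintro ⟨O, hO⟩
    exact le_branchWidth (hO.one_lt_ncard_edgeSet hk) (hO.le_width hk)
  · intro h
    by_contra hO
    exact ((forces_top_of_not_exists_isTangle (by omega) hO).branchWidth_lt hk).not_ge h

end TangleToBranchWidth

section StarForests

variable {V : Type*} {G : SimpleGraph V}

/-- `c` is a centre: its neighbours have no neighbour other than `c`. -/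
def IsCentre (G : SimpleGraph V) (c : V) : Prop :=
  ∀ x, G.Adj c x → (G.neighborSet x).Subsingleton

theorem IsCentre.eq_or_adj {c x : V} (hc : IsCentre G c) (h : G.Reachable x c) :
    x = c ∨ G.Adj c x := by
  obtain ⟨p⟩ := h
  induction p with
  | nil => exact .inl rfl
  | cons hxy p ih =>
    rcases ih hc with rfl | hcy
    · exact .inr hxy.symm
    · exact .inl (hc _ hcy hxy.symm hcy.symm)

theorem isStarForest_of_forall_exists_isCentre
    (h : ∀ C : G.ConnectedComponent, ∃ c ∈ C.supp, IsCentre G c) : IsStarForest G := by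
  intro C
  obtain ⟨c, hcC, hc⟩ := h C
  have h_near : ∀ x ∈ C.supp, x = c ∨ G.Adj c x := fun x hx =>
    hc.eq_or_adj (SimpleGraph.ConnectedComponent.exact (hx.trans hcC.symm))
  refine ⟨⟨c, hcC⟩, ?_⟩
  ext ⟨a, ha⟩ ⟨b, hb⟩
  rw [SimpleGraph.starGraph_adj]
  change G.Adj a b ↔ _
  simp only [ne_eq, Subtype.mk.injEq]
  constructor
  · intro hab
    exact ⟨hab.ne, (h_near a ha).imp_right fun hca => hc a hca hab hca.symm⟩
  · rintro ⟨hab, rfl | rfl⟩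
    · exact (h_near b hb).resolve_left (Ne.symm hab)
    · exact ((h_near a ha).resolve_left hab).symm

theorem isStarForest_of_forall_adj
    (h : ∀ u v, G.Adj u v → (G.neighborSet u).Subsingleton ∨ (G.neighborSet v).Subsingleton) :
    IsStarForest G := by
  refine isStarForest_of_forall_exists_isCentre fun C => ?_
  by_cases h_nontrivial : ∃ c ∈ C.supp, ¬ (G.neighborSet c).Subsingleton
  · obtain ⟨c, hcC, hc⟩ := h_nontrivial
    exact ⟨c, hcC, fun x hcx => (h c x hcx).resolve_left hc⟩
  · push Not at h_nontrivial
    obtain ⟨c, hcC⟩ := C.nonempty_supp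
    exact ⟨c, hcC, fun x hcx => h_nontrivial x ((C.mem_supp_congr_adj hcx).1 hcC)⟩

end StarForests

section SmallOrder

variable {V : Type*} [Finite V] {G : SimpleGraph V}

theorem exists_isTangle_two_iff : (∃ O, IsTangle G 2 O) ↔ G.edgeSet.Nonempty := by
  refine ⟨fun ⟨O, hO⟩ => hO.edgeSet_nonempty le_rfl, ?_⟩
  rintro ⟨⟨u, v⟩, huv : G.Adj u v⟩
  exact ⟨_, (isCell_pair huv).isTangle (Set.ncard_pair huv.ne).ge⟩

theorem two_le_branchWidth (h : ¬ IsStarForest G) : 2 ≤ branchWidth G := by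
  obtain ⟨u, v, huv, hu, hv⟩ : ∃ u v, G.Adj u v ∧ (G.neighborSet u).Nontrivial ∧
      (G.neighborSet v).Nontrivial := by
    contrapose! h
    exact isStarForest_of_forall_adj fun u v huv => or_iff_not_imp_left.2 fun hu =>
      h u v huv (Set.not_subsingleton_iff.1 hu)
  obtain ⟨w, huw, hwv⟩ := hu.exists_ne v
  obtain ⟨x, hvx, hxu⟩ := hv.exists_ne u
  have hf : s(u, w) ≠ s(u, v) := fun h => hwv (Sym2.congr_right.1 h)
  have hg : s(v, x) ≠ s(u, v) := fun h => hxu (Sym2.congr_right.1 (h.trans Sym2.eq_swap))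
  have hE : 1 < G.edgeSet.ncard :=
    (Set.one_lt_ncard (Set.toFinite _)).2 ⟨s(u, w), huw, s(u, v), huv, hf⟩
  refine le_branchWidth hE fun X => ?_
  -- The edge at the leaf of `uv` has both `u` and `v` on its other side as well.
  obtain ⟨e, -, h_leaf, h⟩ := X.exists_dart_leaf ⟨s(u, v), huv⟩
  rw [← Set.ncard_pair huv.ne]
  refine (Set.ncard_le_ncard ?_).trans (X.edgeOrder_le_width e)
  refine Set.subset_inter (Set.pair_subset ?_ ?_) (Sym2.coe_mk.ge.trans h_leaf)
  · exact h ⟨s(u, w), huw⟩ (fun h => hf (congrArg Subtype.val h)) (Sym2.mem_mk_left u w)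
  · exact h ⟨s(v, x), hvx⟩ (fun h => hg (congrArg Subtype.val h)) (Sym2.mem_mk_left v x)

theorem edgeSet_nonempty_iff :
    G.edgeSet.Nonempty ↔ 2 ≤ branchWidth G ∨ (IsStarForest G ∧ G.edgeSet.Nonempty) := by
  constructor
  · intro hE
    by_cases hG : IsStarForest G
    exacts [.inr ⟨hG, hE⟩, .inl (two_le_branchWidth hG)]
  · rintro (h | h)
    · by_contra hE
      rw [branchWidth_eq_zero (by simp [Set.not_nonempty_iff_eq_empty.1 hE])] at h
      omega
    · exact h.2

theorem exists_isTangle_iff [Nonempty V] {k : ℕ} (hk : 0 < k) : (∃ O, IsTangle G k O) ↔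
    k ≤ branchWidth G ∨ (k ≤ 2 ∧ IsStarForest G ∧ G.edgeSet.Nonempty) ∨
      (k = 1 ∧ G.edgeSet = ∅) := by
  obtain rfl | rfl | hk3 : k = 1 ∨ k = 2 ∨ 3 ≤ k := by omega
  · refine iff_of_true exists_isTangle_one ?_
    obtain hE | hE := G.edgeSet.eq_empty_or_nonempty
    · exact .inr (.inr ⟨rfl, hE⟩)
    · exact (edgeSet_nonempty_iff.1 hE).imp one_le_two.trans fun h => .inl ⟨one_le_two, h⟩
  · exact exists_isTangle_two_iff.trans (edgeSet_nonempty_iff.trans (by simp))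
  · rw [exists_isTangle_iff_le_branchWidth hk3]
    omega

end SmallOrder

end TangleDuality

theorem mainTheorem4 {V : Type*} [Finite V] [Nonempty V] (G : SimpleGraph V) (k : ℕ) (hk : 0 < k) :
    List.TFAE [
      ∃ O, TangleDuality.IsTangle G k O,
      ∃ O, TangleDuality.IsFTangle (TangleDuality.sepsBelow G k) (TangleDuality.tangleF G k) O,
      ∃ O, TangleDuality.IsFTangle (TangleDuality.sepsBelow G k) (TangleDuality.tangleFStar G k) O,
      ¬ ∃ X : TangleDuality.STree (TangleDuality.sepsBelow G k),
        X.IsOver (TangleDuality.tangleFStar G k),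
      k ≤ TangleDuality.branchWidth G ∨
        (k ≤ 2 ∧ TangleDuality.IsStarForest G ∧ G.edgeSet.Nonempty) ∨
        (k = 1 ∧ G.edgeSet = ∅)] := by
  tfae_have 1 → 2 := fun ⟨O, hO⟩ => ⟨O, hO.isFTangle⟩
  tfae_have 2 → 3 := fun ⟨O, hO⟩ => ⟨O, hO.orientation, hO.consistent, fun σ hσ => hO.avoids σ hσ.1⟩
  tfae_have 3 → 4 := fun ⟨O, hO⟩ ⟨X, hX⟩ => hO.orientation.not_isOver hO.avoids X hX
  tfae_have 4 → 1 := fun h => by_contra fun hO =>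
    h ((TangleDuality.forces_top_of_not_exists_isTangle hk hO).exists_isOver hk)
  tfae_have 1 ↔ 5 := TangleDuality.exists_isTangle_iff hk
  tfae_finish
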